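/- All vector spaces are over $\mathbb C$; $x,x_0,x_1,x_2,z$ are commuting formal variables, and $U((x))$, $U((x_1,x_2))$ denote spaces of formal Laurent series with exponents bounded below (in each variable). Rational expressions such as $(x_1-x_2)^n$ ($n\in\mathbb Z$) are expanded in nonnegative powers of the second variable, i.e. in $\mathbb C((x_1))((x_2))$; more generally $\iota_{x_1,x_2}$ is the embedding of the fraction field of $\mathbb C[[x_1,x_2]]$ into $\mathbb C((x_1))((x_2))$ extending the inclusion of $\mathbb C[[x_1,x_2]]$. Put $\delta(x)=\sum_{n\in\mathbb Z}x^n$ and $\log(1+z)=\sum_{n\ge1}(-1)^{n-1}z^n/n$. A *weak quantum vertex algebra* is a vector space $V$ with a linear map $Y(\cdot,x):V\to\mathrm{Hom}(V,V((x)))$ and a vector $\mathbf 1\in V$ such that $Y(\mathbf 1,x)v=v$, $Y(v,x)\mathbf 1\in V[[x]]$ and $\lim_{x\to0}Y(v,x)\mathbf 1=v$ for all $v\in V$, and such that for all $u,v\in V$ there are finitely many $u^{(i)},v^{(i)}\in V$, $f_i(x)\in\mathbb C((x))$ with $$x_0^{-1}\delta\Big(\frac{x_1-x_2}{x_0}\Big)Y(u,x_1)Y(v,x_2)-x_0^{-1}\delta\Big(\frac{x_2-x_1}{-x_0}\Big)\sum_i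 f_i(x_2-x_1)Y(v^{(i)},x_2)Y(u^{(i)},x_1)=x_2^{-1}\delta\Big(\frac{x_1-x_0}{x_2}\Big)Y(Y(u,x_0)v,x_2).$$ A *$\phi$-coordinated quasi $V$-module* (with $\phi(x,z)=xe^z$) is a vector space $W$ with a linear map $Y_W(\cdot,x):V\to\mathrm{Hom}(W,W((x)))$ such that $Y_W(\mathbf 1,x)=1_W$ and such that for all $u,v\in V$ there is a nonzero polynomial $p(x)\in\mathbb C[x]$ with $p(x_1/x_2)Y_W(u,x_1)Y_W(v,x_2)\in\mathrm{Hom}(W,W((x_1,x_2)))$ and $$p(e^z)Y_W(Y(u,z)v,x_2)=\big(p(x_1/x_2)Y_W(u,x_1)Y_W(v,x_2)\big)\big|_{x_1=x_2e^z}.$$ **Proposition.** Let $V$ be a weak quantum vertex algebra, let $(W,Y_W)$ be a $\phi$-coordinated quasi $V$-module, and let $u,v\in V$. Assume that $u^{(i)},v^{(i)}\in V$ and rational functions $f_i(x)\in\mathbb C(x)$ $(i=1,\dots,r)$ are such that, for some nonnegative integer $k$, $$(x_1-x_2)^kY(u,x_1)Y(v,x_2)=(x_1-x_2)^k\sum_{i=1}^r\iota_{x_2,x_1}\big(f_i(e^{x_1-x_2})\big)Y(v^{(i)},x_2)Y(u^{(i)},x_1).$$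 Then there exists a nonzero polynomial $p(x)\in\mathbb C[x]$ such that $$(xz)^{-1}\delta\Big(\frac{x_1-x}{xz}\Big)p(x_1/x)Y_W(u,x_1)Y_W(v,x)-(xz)^{-1}\delta\Big(\frac{x-x_1}{-xz}\Big)p(x_1/x)\sum_{i=1}^r\iota_{x,x_1}\big(f_i(x_1/x)\big)Y_W(v^{(i)},x)Y_W(u^{(i)},x_1)$$ $$=x_1^{-1}\delta\Big(\frac{x(1+z)}{x_1}\Big)p(x_1/x)Y_W\big(Y(u,\log(1+z))v,x\big).$$ -/

import Mathlib

noncomputable section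

open Polynomial

/-! Formal series.  `U((x))` is `HahnModule ℤ ℂ U`, a module over the field `ℂ((x))`, and
`U((x))((y))` is `LaurentTwo U`, a module over the field `ℂ((x))((y))`.  In an iterated series the
*inner* variable is `x` and the *outer* variable is `y`: a series of
`U((x))((y))` has, for each power of the outer variable, a coefficient in `U((x))`, and only
finitely many negative powers of the outer variable occur. -/

/-- The field `ℂ((x))((y))`. -/
def ScalarTwo : Type := LaurentSeries (LaurentSeries ℂ)

/-- The space `U((x))((y))`, as a module over `ℂ((x))((y))`. -/
def LaurentTwo (U : Type*) [AddCommGroup U] [Module ℂ U] : Type _ :=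
  HahnModule ℤ (LaurentSeries ℂ) (HahnModule ℤ ℂ U)

namespace ScalarTwo

instance : Field ScalarTwo := inferInstanceAs (Field (LaurentSeries (LaurentSeries ℂ)))

/-- Complex numbers as constant series. -/
instance : Algebra ℂ ScalarTwo := RingHom.toAlgebra
  (((HahnSeries.C : LaurentSeries ℂ →+* LaurentSeries (LaurentSeries ℂ)).comp
    (HahnSeries.C : ℂ →+* LaurentSeries ℂ) : ℂ →+* LaurentSeries (LaurentSeries ℂ)) :
    ℂ →+* ScalarTwo)

instance (U : Type*) [AddCommGroup U] [Module ℂ U] : AddCommGroup (LaurentTwo U) :=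
  inferInstanceAs (AddCommGroup (HahnModule ℤ (LaurentSeries ℂ) (HahnModule ℤ ℂ U)))

instance (U : Type*) [AddCommGroup U] [Module ℂ U] : Module ScalarTwo (LaurentTwo U) :=
  inferInstanceAs (Module (LaurentSeries (LaurentSeries ℂ))
    (HahnModule ℤ (LaurentSeries ℂ) (HahnModule ℤ ℂ U)))

/-- An element of `ScalarTwo` from its iterated Laurent series. -/
def mk (g : LaurentSeries (LaurentSeries ℂ)) : ScalarTwo := g

/-- The iterated Laurent series of an element of `ScalarTwo`. -/
def toSeries (g : ScalarTwo) : LaurentSeries (LaurentSeries ℂ) := g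

/-- A series in the inner variable: the inclusion `ℂ((x)) ⊂ ℂ((x))((y))`. -/
def inInner (g : LaurentSeries ℂ) : ScalarTwo := mk (HahnSeries.C g)

/-- A series in the outer variable: the inclusion `ℂ((y)) ⊂ ℂ((x))((y))`. -/
def inOuter (g : LaurentSeries ℂ) : ScalarTwo :=
  mk (g.map (HahnSeries.C : ℂ →+* LaurentSeries ℂ))

/-- The inner variable `x` of `ℂ((x))((y))`. -/
def varInner : ScalarTwo := inInner (HahnSeries.single 1 1)

/-- The outer variable `y` of `ℂ((x))((y))`. -/
def varOuter : ScalarTwo := inOuter (HahnSeries.single 1 1)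

end ScalarTwo

/-- The exponential series `e^x` in `ℂ((x))`. -/
def expSeries : LaurentSeries ℂ := ((PowerSeries.exp ℂ : PowerSeries ℂ) : LaurentSeries ℂ)

/-- The series `log (1 + z) = ∑_{n ≥ 1} (-1)^{n-1} z^n / n` in `ℂ((z))` (the term with `n = 0`
is `0`, since division by zero gives zero). -/
def logSeries : LaurentSeries ℂ :=
  ((PowerSeries.mk fun n : ℕ => (-1 : ℂ) ^ (n + 1) / (n : ℂ) : PowerSeries ℂ) : LaurentSeries ℂ)

/-- `f(x - y) = e^{-y d/dx} f(x) = ∑_{k ≥ 0} (-y)^k / k! · f^{(k)}(x)` in `ℂ((x))((y))`, for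
`f ∈ ℂ((x))`. -/
def shiftSub (f : LaurentSeries ℂ) : ScalarTwo :=
  ScalarTwo.mk ((PowerSeries.mk fun k : ℕ => (-1 : ℂ) ^ k • LaurentSeries.hasseDeriv ℂ k f :
    PowerSeries (LaurentSeries ℂ)) : LaurentSeries (LaurentSeries ℂ))

section Series

variable {U W : Type*} [AddCommGroup U] [Module ℂ U] [AddCommGroup W] [Module ℂ W]

/-- The coefficient of `x^i` in a series of `U((x))`. -/
def coeffOne (s : HahnModule ℤ ℂ U) (i : ℤ) : U := ((HahnModule.of ℂ).symm s).coeff i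

/-- The coefficient of (inner variable)`^i` (outer variable)`^j` in a series of `U((x))((y))`. -/
def coeffTwo (s : LaurentTwo U) (i j : ℤ) : U :=
  coeffOne (((HahnModule.of (LaurentSeries ℂ)).symm s).coeff j) i

/-- For `T(x) : U → W((x))` linear and `s(y) = ∑ s_n y^n` in `U((y))`, the series
`T(x) s(y) = ∑ T(x)(s_n) y^n` of `W((x))((y))`. -/
def applyCoeff (T : U →ₗ[ℂ] HahnModule ℤ ℂ W) (s : HahnModule ℤ ℂ U) : LaurentTwo W :=
  HahnModule.of (LaurentSeries ℂ) (((HahnModule.of ℂ).symm s).map T)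

/-- A doubly infinite series `∑ A i j x₁^i x₂^j` lies in `W((x₁, x₂))`: the exponents of both
variables are bounded below. -/
def IsJointLaurent (A : ℤ → ℤ → W) : Prop :=
  ∃ N : ℤ, ∀ i j : ℤ, i < N ∨ j < N → A i j = 0

/-- For `A(x₁, x₂) = ∑ A i j x₁^i x₂^j` in `W((x₁, x₂))`, the coefficient of `x₂^b z^c` in
`A(x₂ e^z, x₂)`, where `(x₂ e^z)^i = x₂^i (e^z)^i` (a finite sum). -/
def substExpCoeff (A : ℤ → ℤ → W) (b c : ℤ) : W :=
  ∑ᶠ i : ℤ, (expSeries ^ i).coeff c • A i (b - i)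

/-- Multiplication by `p(x₁/x)`, for a polynomial `p`, of a formal series
`∑ F a b c x₁^a x^b z^c` with coefficients in `W` that is infinite in all directions. -/
def ratioMul (p : ℂ[X]) (F : ℤ → ℤ → ℤ → W) (a b c : ℤ) : W :=
  p.sum fun k r => r • F (a - k) (b + k) c

end Series

theorem logSeries_eq : ∃ g : (PowerSeries ℂ)ˣ,
    logSeries = HahnSeries.single 1 1 * ((g : PowerSeries ℂ) : LaurentSeries ℂ) := by
  have hu : IsUnit (PowerSeries.mk fun n : ℕ => (-1 : ℂ) ^ n / ((n : ℂ) + 1)) := by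
    rw [PowerSeries.isUnit_iff_constantCoeff]
    simp [← PowerSeries.coeff_zero_eq_constantCoeff_apply]
  refine ⟨hu.unit, ?_⟩
  rw [IsUnit.unit_spec, logSeries, ← PowerSeries.coe_X, ← PowerSeries.coe_mul]
  congr 1
  ext n
  cases n with
  | zero => simp
  | succ n => simp [PowerSeries.coeff_succ_X_mul, pow_succ]

/-- `log (1 + z)^m` lies in `z^m ℂ[[z]]` for every integer `m`. -/
theorem coeff_logSeries_zpow {m n : ℤ} (h : n < m) : (logSeries ^ m).coeff n = 0 := by
  obtain ⟨g, hg⟩ := logSeries_eq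
  have key : ∃ q : PowerSeries ℂ,
      (((g : PowerSeries ℂ) : LaurentSeries ℂ)) ^ m = (q : LaurentSeries ℂ) := by
    refine ⟨((g ^ m : (PowerSeries ℂ)ˣ) : PowerSeries ℂ), ?_⟩
    have := (Units.coe_map_inv (HahnSeries.ofPowerSeries ℤ ℂ : PowerSeries ℂ →* LaurentSeries ℂ) g)
    have h2 := map_zpow (Units.map
      (HahnSeries.ofPowerSeries ℤ ℂ : PowerSeries ℂ →* LaurentSeries ℂ)) g m
    have h3 := congrArg (Units.val) h2
    rw [Units.val_zpow_eq_zpow_val] at h3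
    exact h3.symm
  obtain ⟨q, hq⟩ := key
  have hs : (HahnSeries.single (1 : ℤ) (1 : ℂ)) ^ m = HahnSeries.single m 1 := by
    rw [← RatFunc.single_zpow]
  rw [hg, mul_zpow, hs, hq]
  have h4 := HahnSeries.coeff_single_mul_add (r := (1 : ℂ)) (x := (q : LaurentSeries ℂ))
    (a := n - m) (b := m)
  rw [sub_add_cancel] at h4
  rw [h4, PowerSeries.coeff_coe, if_pos (by omega), mul_zero]

section Series

variable {U : Type*} [AddCommGroup U] [Module ℂ U]

/-- For `s(z) = ∑ s_m z^m` in `U((z))`, the series `s(log (1 + z)) = ∑ s_m (log (1 + z))^m` of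
`U((z))`; every coefficient is a finite sum. -/
def substLog (s : HahnModule ℤ ℂ U) : HahnModule ℤ ℂ U :=
  HahnModule.of ℂ <| HahnSeries.ofSuppBddBelow
    (fun n : ℤ => ∑ᶠ m : ℤ, (logSeries ^ m).coeff n • coeffOne s m) <|
    ⟨((HahnModule.of ℂ).symm s).order, fun n hs => by
      by_contra hn
      refine hs ?_
      refine finsum_eq_zero_of_forall_eq_zero fun m => ?_
      by_cases hm : m < ((HahnModule.of ℂ).symm s).order
      · rw [coeffOne, HahnSeries.coeff_eq_zero_of_lt_order hm, smul_zero]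
      · rw [coeff_logSeries_zpow (by omega), zero_smul]⟩

end Series

section Operators

variable {V W : Type*} [AddCommGroup V] [Module ℂ V] [AddCommGroup W] [Module ℂ W]

/-- `a(x₁) b(x₂) w` in `W((x₁))((x₂))` (inner variable `x₁`, outer variable `x₂`). -/
def prodOp (a b : VertexOperator ℂ W) (w : W) : LaurentTwo W := applyCoeff a (b w)

/-- `∑_i g_i(x₂, x₁) Y(v⁽ⁱ⁾, x₂) Y(u⁽ⁱ⁾, x₁) w` in `W((x₂))((x₁))` (inner variable `x₂`, outer
variable `x₁`), for scalars `g_i` in `ℂ((x₂))((x₁))`. -/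
def revProd (Y : V →ₗ[ℂ] VertexOperator ℂ W) {r : ℕ} (g : Fin r → ScalarTwo)
    (u' v' : Fin r → V) (w : W) : LaurentTwo W :=
  ∑ i, g i • prodOp (Y (v' i)) (Y (u' i)) w

/-- `Y(s(z), x) w` in `W((x))((z))` for `s(z)` in `V((z))` (inner variable `x`, outer
variable `z`). -/
def iterOp (Y : V →ₗ[ℂ] VertexOperator ℂ W) (s : HahnModule ℤ ℂ V) (w : W) : LaurentTwo W :=
  applyCoeff (Y.flip w) s

end Operators

open ScalarTwo

/-- The coefficient of `x₁^b` in `x₂⁻¹ δ((x₁ - x₀)/x₂) = ∑_n x₂^{-n-1} (x₁ - x₀)^n`, where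
`(x₁ - x₀)^n = ∑_{k ≥ 0} (n choose k) (-1)^k x₁^{n-k} x₀^k`: only `n = b + k` contributes, and the
result lies in `ℂ((x₂))((x₀))` (inner variable `x₂`, outer variable `x₀`). -/
def jacobiDelta (b : ℤ) : ScalarTwo :=
  ScalarTwo.mk ((PowerSeries.mk fun k : ℕ =>
    (HahnSeries.single (-(b + k) - 1) ((-1 : ℂ) ^ k * ((Ring.choose (b + k : ℤ) k : ℤ) : ℂ)) :
      LaurentSeries ℂ) : PowerSeries (LaurentSeries ℂ)) : LaurentSeries (LaurentSeries ℂ))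

/-- A weak quantum vertex algebra structure on a complex vector space `V`. -/
structure WeakQuantumVertexAlgebra (V : Type*) [AddCommGroup V] [Module ℂ V] where
  /-- the vertex operator map `v ↦ Y(v, x) ∈ Hom(V, V((x)))` -/
  Y : V →ₗ[ℂ] VertexOperator ℂ V
  /-- the vacuum vector -/
  vac : V
  Y_vac : ∀ v, Y vac v = HahnModule.of ℂ (HahnSeries.single 0 v)
  creation : ∀ v, ∀ n < 0, coeffOne (Y v vac) n = 0
  creation_zero : ∀ v, coeffOne (Y v vac) 0 = v
  /-- The `S`-Jacobi identity, as an equality of the coefficients of `x₀^a x₁^b x₂^c`. The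
  coefficient of `x₀^a` in `x₀⁻¹ δ((x₁ - x₂)/x₀)` is `(x₁ - x₂)^{-a-1}`, in the field
  `ℂ((x₁))((x₂))`; the one in `x₀⁻¹ δ((x₂ - x₁)/(-x₀))` is `(-1)^{-a-1} (x₂ - x₁)^{-a-1}`, in
  `ℂ((x₂))((x₁))`. -/
  jacobi : ∀ u v, ∃ (r : ℕ) (u' v' : Fin r → V) (f : Fin r → LaurentSeries ℂ),
    ∀ (w : V) (a b c : ℤ),
      coeffTwo ((varInner - varOuter) ^ (-a - 1) • prodOp (Y u) (Y v) w) b c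
        - coeffTwo (((-1) ^ (-a - 1) * (varInner - varOuter) ^ (-a - 1)) •
            revProd Y (fun i => shiftSub (f i)) u' v' w) c b
      = coeffTwo (jacobiDelta b • iterOp Y (Y u v) w) c a

/-- A `φ`-coordinated quasi module `W`, with `φ(x, z) = x e^z`, for a weak quantum vertex
algebra. -/
structure PhiCoordinatedQuasiModule {V : Type*} [AddCommGroup V] [Module ℂ V]
    (A : WeakQuantumVertexAlgebra V) (W : Type*) [AddCommGroup W] [Module ℂ W] where
  /-- the map `v ↦ Y_W(v, x) ∈ Hom(W, W((x)))` -/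
  Y : V →ₗ[ℂ] VertexOperator ℂ W
  Y_vac : ∀ w, Y A.vac w = HahnModule.of ℂ (HahnSeries.single 0 w)
  /-- `p(x₁/x₂) Y_W(u, x₁) Y_W(v, x₂) ∈ Hom(W, W((x₁, x₂)))` and
  `p(e^z) Y_W(Y(u, z)v, x₂) = (p(x₁/x₂) Y_W(u, x₁) Y_W(v, x₂))|_{x₁ = x₂ e^z}`. -/
  assoc : ∀ u v, ∃ p : ℂ[X], p ≠ 0 ∧ ∀ w : W,
    IsJointLaurent (coeffTwo (aeval (varInner / varOuter) p • prodOp (Y u) (Y v) w)) ∧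
    ∀ b c : ℤ,
      coeffTwo (aeval (inOuter expSeries) p • iterOp Y (A.Y u v) w) b c
        = substExpCoeff (coeffTwo (aeval (varInner / varOuter) p • prodOp (Y u) (Y v) w)) b c

/-- The relation
`(x₁ - x₂)^k Y(u, x₁) Y(v, x₂) = (x₁ - x₂)^k ∑_i ι_{x₂,x₁}(f_i(e^{x₁ - x₂})) Y(v⁽ⁱ⁾, x₂) Y(u⁽ⁱ⁾, x₁)`
on `V`, for rational functions `f_i`, as an equality of the coefficients of `x₁^b x₂^c`. On the
right the inner variable is `x₂`, the outer one is `x₁`, and `e^{x₁ - x₂} = e^{x₁} / e^{x₂}`. -/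
def TrigLocality {V : Type*} [AddCommGroup V] [Module ℂ V] (A : WeakQuantumVertexAlgebra V)
    (u v : V) {r : ℕ} (u' v' : Fin r → V) (f : Fin r → RatFunc ℂ) (k : ℕ) : Prop :=
  ∀ (w : V) (b c : ℤ),
    coeffTwo ((varInner - varOuter) ^ k • prodOp (A.Y u) (A.Y v) w) b c
      = coeffTwo ((varOuter - varInner) ^ k • revProd A.Y
          (fun i => (f i).eval (algebraMap ℂ ScalarTwo)
            (inOuter expSeries / inInner expSeries)) u' v' w) c b

end

/-!
The proof pairs everything with a linear form `μ` on the module, so that all series have complex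
coefficients and live in the field `ScalarTwo`, and then uses homogeneity: the scalars occurring in
the theorem depend on `x₁` and `x` only through `t = x₁/x`, up to a power of one variable. The
component of total degree `n` of a matrix coefficient (`ScalarTwo.diag`, or `ScalarTwo.slice` for
the iterate `Y_W(Y(u, z)v, x)`) is a Laurent series in one variable.

Weak associativity says that these one-variable series are expansions of rational functions
(`exists_rational`): there is `R ∈ ℂ(t)`, with `p R` a Laurent polynomial for the polynomial `p` of
weak associativity, such that `Y_W(u, x₁) Y_W(v, x)` gives the expansion of `R` at `t = ∞`, and
`Y_W(Y(u, z)v, x)` gives the expansion of `R(e^z)`. As `ℂ` is algebraically closed, all these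
expansions are evaluations at transcendental elements of fields (`ratEval`), hence injective
homomorphisms on `ℂ(t)`. For `v = 𝟏` this gives `Y_W(Y(a, z)𝟏, x) = Y_W(a, xe^z)`
(`slice_iterOp_vac`).

On `V`, the `S`-Jacobi identity on the vacuum vector and the trigonometric locality relation give
skew symmetry in the form `Y(u, z)v = ∑ f_i(e^z) Y(Y(v⁽ⁱ⁾, -z)u⁽ⁱ⁾, z)𝟏` (`skew_symmetry`). Applying
`Y_W(·, x)` and the vacuum property, one gets `R(t) = ∑ f_i(t) t^n R_i(1/t)`, where `R_i` is the
rational function belonging to `v⁽ⁱ⁾, u⁽ⁱ⁾`. So the product in the opposite order is the expansion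
of the same `R` at `t = 0` (`diag_revProd`), and `z ↦ log (1 + z)` turns `R(e^z)` into `R(1 + z)`
(`slice_iterOp_substLog`).

The theorem thus holds with the polynomial `p` of weak associativity for `u, v`, and it is reduced
to the Laurent polynomial `p R`, hence to a monomial `t^i`. There it is the residue identity
`coeff_expansion_sub`, comparing the expansions of a power of `t - 1` at `∞`, `0` and `1`.
-/

noncomputable section

open Polynomial ScalarTwo

/-! ### Coefficientwise maps of Laurent series -/

/-- The series `∑ φ_j(x_j) T^j`, for additive maps `φ_j` and a Laurent series `x = ∑ x_j T^j`. -/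
def coeffwise {S S' : Type*} [AddCommGroup S] [AddCommGroup S'] (φ : ℤ → S →+ S') :
    HahnSeries ℤ S →+ HahnSeries ℤ S' where
  toFun x :=
    { coeff := fun j => φ j (x.coeff j)
      isPWO_support' := x.isPWO_support.mono fun j hj hx => hj (by simp [hx]) }
  map_zero' := by ext; simp
  map_add' x y := by ext; simp

@[simp]
theorem coeffwise_coeff {S S' : Type*} [AddCommGroup S] [AddCommGroup S'] (φ : ℤ → S →+ S')
    (x : HahnSeries ℤ S) (j : ℤ) : (coeffwise φ x).coeff j = φ j (x.coeff j) := rfl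

/-- Coefficientwise maps are compatible with products as soon as they are so on monomials. -/
theorem coeffwise_mul {A B C : Type*} [Ring A] [Ring B] [Ring C]
    (α : ℤ → A →+ B) (β : ℤ → B →+ C) (γ : ℤ → A →+ C)
    (h : ∀ k l (a : A) (b : B), β (k + l) (α k a * b) = γ k a * β l b)
    (x : HahnSeries ℤ A) (y : HahnSeries ℤ B) :
    coeffwise β (coeffwise α x * y) = coeffwise γ x * coeffwise β y := by
  classical
  ext n
  rw [coeffwise_coeff, HahnSeries.coeff_mul_left' (s := x.support) x.isPWO_support
    (fun j hj hx => hj (by simp [show x.coeff j = 0 from hx])), map_sum, HahnSeries.coeff_mul]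
  refine Eq.symm (Eq.trans (Finset.sum_subset (fun p hp => ?_) fun p hp hz => ?_)
    (Finset.sum_congr rfl fun p hp => ?_))
  · simp only [Finset.mem_antidiagonal, HahnSeries.mem_support, coeffwise_coeff] at hp ⊢
    exact ⟨fun h0 => hp.1 (by simp [h0]), fun h0 => hp.2.1 (by simp [h0]), hp.2.2⟩
  · simp only [Finset.mem_antidiagonal, HahnSeries.mem_support, coeffwise_coeff] at hp hz ⊢
    by_contra hne
    exact hz ⟨left_ne_zero_of_mul hne, right_ne_zero_of_mul hne, hp.2.2⟩
  · rw [Finset.mem_antidiagonal] at hp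
    rw [← hp.2.2, coeffwise_coeff, coeffwise_coeff, coeffwise_coeff, h]

/-- The ring homomorphism `∑ x_j T^j ↦ ∑ χ(j) φ(x_j) T^j`, for a ring homomorphism `φ` and a
character `χ` of `ℤ`. -/
def twist {A B : Type*} [CommRing A] [CommRing B] (φ : A →+* B) (χ : Multiplicative ℤ →* B) :
    HahnSeries ℤ A →+* HahnSeries ℤ B where
  toFun := coeffwise fun j => (AddMonoidHom.mulLeft (χ (Multiplicative.ofAdd j))).comp
    (φ : A →+ B)
  map_zero' := map_zero _
  map_add' := map_add _
  map_one' := by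
    ext j
    by_cases hj : j = 0
    · simp [hj]
    · simp [HahnSeries.coeff_one, hj]
  map_mul' x y := by
    have := coeffwise_mul (fun _ => AddMonoidHom.id A)
      (fun j => (AddMonoidHom.mulLeft (χ (Multiplicative.ofAdd j))).comp (φ : A →+ B))
      (fun j => (AddMonoidHom.mulLeft (χ (Multiplicative.ofAdd j))).comp (φ : A →+ B))
      (fun k l a b => by simp [ofAdd_add]; ring) x y
    exact this

@[simp]
theorem twist_coeff {A B : Type*} [CommRing A] [CommRing B] (φ : A →+* B)
    (χ : Multiplicative ℤ →* B) (x : HahnSeries ℤ A) (j : ℤ) :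
    (twist φ χ x).coeff j = χ (Multiplicative.ofAdd j) * φ (x.coeff j) := rfl

/-- A linear form on `M`, applied to the coefficients of the series of `M((x))`. -/
def mapSeries {R M : Type*} [CommRing R] [AddCommGroup M] [Module R M] (f : M →ₗ[R] R) :
    HahnModule ℤ R M →ₗ[HahnSeries ℤ R] HahnSeries ℤ R where
  toFun s := coeffwise (fun _ => (f : M →+ R)) ((HahnModule.of R).symm s)
  map_add' s t := by ext; simp
  map_smul' g s := by
    classical
    ext n
    rw [RingHom.id_apply, smul_eq_mul, coeffwise_coeff, HahnModule.coeff_smul, map_sum,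
      HahnSeries.coeff_mul]
    refine Eq.symm (Eq.trans (Finset.sum_subset (fun p hp => ?_) fun p hp hz => ?_)
      (Finset.sum_congr rfl fun p hp => ?_))
    · simp only [Finset.mem_antidiagonal, Finset.mem_vaddAntidiagonal, HahnSeries.mem_support,
        coeffwise_coeff] at hp ⊢
      exact ⟨hp.1, fun h0 => hp.2.1 (by simp [h0]), hp.2.2⟩
    · simp only [Finset.mem_antidiagonal, Finset.mem_vaddAntidiagonal, HahnSeries.mem_support,
        coeffwise_coeff] at hp hz ⊢
      by_contra hne
      exact hz ⟨left_ne_zero_of_mul hne, right_ne_zero_of_mul hne, hp.2.2⟩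
    · simp

theorem coeff_mul_eq_finsum (g h : LaurentSeries ℂ) (n : ℤ) :
    (g * h).coeff n = ∑ᶠ j : ℤ, g.coeff (n - j) * h.coeff j := by
  classical
  rw [HahnSeries.coeff_mul, finsum_eq_sum_of_support_subset (s := (Finset.antidiagonal
    g.isPWO_support h.isPWO_support n).image Prod.snd), Finset.sum_image]
  · refine Finset.sum_congr rfl fun p hp => ?_
    rw [Finset.mem_antidiagonal] at hp
    rw [← hp.2.2, add_sub_cancel_right]
  · intro p hp q hq hpq
    rw [Finset.mem_coe, Finset.mem_antidiagonal] at hp hq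
    exact Prod.ext (by have := hp.2.2; have := hq.2.2; omega) hpq
  · intro j hj
    rw [Finset.coe_image, Set.mem_image]
    exact ⟨(n - j, j), by
      rw [Finset.mem_coe, Finset.mem_antidiagonal]
      exact ⟨left_ne_zero_of_mul hj, right_ne_zero_of_mul hj, sub_add_cancel n j⟩, rfl⟩

/-- The variable of `ℂ((τ))`. -/
abbrev varT : LaurentSeries ℂ := HahnSeries.single 1 1

/-! ### Scalars in two variables -/

namespace ScalarTwo

/-- The coefficient of (inner variable)`^i` (outer variable)`^j`. -/
def coeff (g : ScalarTwo) (i j : ℤ) : ℂ := (g.toSeries.coeff j).coeff i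

@[ext]
theorem ext {g h : ScalarTwo} (H : ∀ i j, g.coeff i j = h.coeff i j) : g = h :=
  HahnSeries.ext (funext fun j => HahnSeries.ext (funext fun i => H i j))

theorem coeff_add (g h : ScalarTwo) (i j : ℤ) :
    (g + h).coeff i j = g.coeff i j + h.coeff i j := rfl

@[simp] theorem coeff_zero (i j : ℤ) : (0 : ScalarTwo).coeff i j = 0 := rfl

/-- The coefficient of the `n`-th power of the inner variable, a series in the outer variable. -/
def slice (n : ℤ) : ScalarTwo →+ LaurentSeries ℂ :=
  coeffwise fun _ => HahnSeries.coeff.addMonoidHom n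

/-- The homogeneous component of degree `n`, divided by the `n`-th power of the inner variable, as
a series in the ratio (outer variable)/(inner variable). -/
def diag (n : ℤ) : ScalarTwo →+ LaurentSeries ℂ :=
  coeffwise fun j => HahnSeries.coeff.addMonoidHom (n - j)

@[simp]
theorem slice_coeff (n : ℤ) (g : ScalarTwo) (j : ℤ) : (slice n g).coeff j = g.coeff n j := rfl

@[simp]
theorem diag_coeff (n : ℤ) (g : ScalarTwo) (j : ℤ) : (diag n g).coeff j = g.coeff (n - j) j := rfl

theorem algebraMap_eq (c : ℂ) :
    algebraMap ℂ ScalarTwo c = mk (HahnSeries.C (HahnSeries.C c)) := rfl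

theorem toSeries_mul (g h : ScalarTwo) : (g * h).toSeries = g.toSeries * h.toSeries := rfl

theorem toSeries_inInner (g : LaurentSeries ℂ) : (inInner g).toSeries = HahnSeries.C g := rfl

theorem toSeries_inOuter (g : LaurentSeries ℂ) :
    (inOuter g).toSeries = twist HahnSeries.C 1 g := by
  refine HahnSeries.ext (funext fun j => ?_)
  rw [twist_coeff, MonoidHom.one_apply, one_mul]
  unfold inOuter mk toSeries
  rw [HahnSeries.map_coeff]

/-- The algebra structure found by instance search on `ℂ((x))` comes from `ℂ[[x]]`. -/
theorem algebraMap_laurentSeries (c : ℂ) :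
    algebraMap ℂ (LaurentSeries ℂ) c = HahnSeries.C c := by
  rw [HahnSeries.algebraMap_apply', ← HahnSeries.ofPowerSeries_C]
  rfl

/-- A ring homomorphism into `ScalarTwo` given by iterated series, fixing the constants. -/
def algHomOfSeries (F : LaurentSeries ℂ →+* LaurentSeries (LaurentSeries ℂ))
    (hF : ∀ c, F (HahnSeries.C c) = HahnSeries.C (HahnSeries.C c)) :
    LaurentSeries ℂ →ₐ[ℂ] ScalarTwo where
  toFun g := mk (F g)
  map_one' := map_one F
  map_mul' := map_mul F
  map_zero' := map_zero F
  map_add' := map_add F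
  commutes' c := by rw [algebraMap_laurentSeries, hF, algebraMap_eq]

theorem twist_C (χ : Multiplicative ℤ →* LaurentSeries ℂ) (c : ℂ) :
    twist HahnSeries.C χ (HahnSeries.C c) = HahnSeries.C (HahnSeries.C c) := by
  refine HahnSeries.ext (funext fun j => ?_)
  by_cases hj : j = 0
  · simp [hj]
  · simp [HahnSeries.C_apply, HahnSeries.coeff_single_of_ne hj]

/-- `ScalarTwo.inInner` as a homomorphism of algebras. -/
def inInnerHom : LaurentSeries ℂ →ₐ[ℂ] ScalarTwo := algHomOfSeries HahnSeries.C fun _ => rfl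

/-- `ScalarTwo.inOuter` as a homomorphism of algebras. -/
def inOuterHom : LaurentSeries ℂ →ₐ[ℂ] ScalarTwo :=
  algHomOfSeries (twist HahnSeries.C 1) (twist_C 1)

/-- The powers of the inverse of a variable. -/
def invVar : Multiplicative ℤ →* LaurentSeries ℂ where
  toFun k := HahnSeries.single (-k.toAdd) 1
  map_one' := rfl
  map_mul' k l := by simp [add_comm]

/-- The embedding of `ℂ((τ))` into `ℂ((x))((y))` with `τ = y/x`; its image consists of the
homogeneous elements of degree `0`. -/
def homog : LaurentSeries ℂ →ₐ[ℂ] ScalarTwo :=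
  algHomOfSeries (twist HahnSeries.C invVar) (twist_C invVar)

theorem toSeries_homog (g : LaurentSeries ℂ) :
    (homog g).toSeries = twist HahnSeries.C invVar g := rfl

theorem inInner_eq (g : LaurentSeries ℂ) : inInner g = inInnerHom g := rfl

theorem inOuter_eq (g : LaurentSeries ℂ) : inOuter g = inOuterHom g := toSeries_inOuter g

theorem coeff_inInner_mul (g : LaurentSeries ℂ) (s : ScalarTwo) (i j : ℤ) :
    (inInner g * s).coeff i j = (g * s.toSeries.coeff j).coeff i := by
  rw [coeff, toSeries_mul, toSeries_inInner, HahnSeries.C_mul_eq_smul, HahnSeries.coeff_smul,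
    smul_eq_mul]

/-- Taking coefficients in the inner variable is linear over the series in the outer variable. -/
theorem slice_inOuter_mul (n : ℤ) (g : LaurentSeries ℂ) (s : ScalarTwo) :
    slice n (inOuter g * s) = g * slice n s := by
  have := coeffwise_mul (fun j => (AddMonoidHom.mulLeft
      ((1 : Multiplicative ℤ →* LaurentSeries ℂ) (Multiplicative.ofAdd j))).comp
      ((HahnSeries.C : ℂ →+* LaurentSeries ℂ) : ℂ →+ LaurentSeries ℂ))
    (fun _ => HahnSeries.coeff.addMonoidHom n) (fun _ => AddMonoidHom.id ℂ)
    (fun k l a b => by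
      change ((1 * HahnSeries.C a) * b).coeff n = a * b.coeff n
      rw [one_mul, HahnSeries.C_mul_eq_smul, HahnSeries.coeff_smul, smul_eq_mul]) g s.toSeries
  change coeffwise _ (inOuter g * s).toSeries = _
  rw [toSeries_mul, toSeries_inOuter]
  exact this

/-- Taking homogeneous components is linear over the series that are homogeneous of degree `0`. -/
theorem diag_homog_mul (n : ℤ) (g : LaurentSeries ℂ) (s : ScalarTwo) :
    diag n (homog g * s) = g * diag n s := by
  have := coeffwise_mul (fun j => (AddMonoidHom.mulLeft
      (invVar (Multiplicative.ofAdd j))).comp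
      ((HahnSeries.C : ℂ →+* LaurentSeries ℂ) : ℂ →+ LaurentSeries ℂ))
    (fun j => HahnSeries.coeff.addMonoidHom (n - j)) (fun _ => AddMonoidHom.id ℂ)
    (fun k l a b => by
      change ((HahnSeries.single (-k) (1 : ℂ) * HahnSeries.C a) * b).coeff (n - (k + l))
        = a * b.coeff (n - l)
      rw [mul_assoc, HahnSeries.coeff_single_mul, one_mul, HahnSeries.C_mul_eq_smul,
        HahnSeries.coeff_smul, smul_eq_mul]
      congr 2
      ring) g s.toSeries
  exact this

theorem varInner_zpow (k : ℤ) : varInner ^ k = inInner (HahnSeries.single k 1) := by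
  rw [varInner, inInner_eq, ← map_zpow₀, ← RatFunc.single_zpow k, inInner_eq]

theorem coeff_varInner_zpow_mul (k : ℤ) (s : ScalarTwo) (i j : ℤ) :
    (varInner ^ k * s).coeff i j = s.coeff (i - k) j := by
  rw [varInner_zpow, coeff_inInner_mul, HahnSeries.coeff_single_mul, one_mul]
  rfl

theorem slice_varInner_zpow_mul (n k : ℤ) (s : ScalarTwo) :
    slice n (varInner ^ k * s) = slice (n - k) s := by
  ext j
  simp [coeff_varInner_zpow_mul]

theorem varInner_ne_zero : varInner ≠ 0 := by
  rw [varInner, inInner_eq, Ne, map_eq_zero]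
  exact HahnSeries.single_ne_zero one_ne_zero

theorem varOuter_ne_zero : varOuter ≠ 0 := by
  rw [varOuter, inOuter_eq, Ne, map_eq_zero]
  exact HahnSeries.single_ne_zero one_ne_zero

theorem homog_varT : homog varT = varOuter / varInner := by
  rw [eq_div_iff varInner_ne_zero]
  ext i j
  rw [mul_comm, ← zpow_one varInner, coeff_varInner_zpow_mul, varOuter, coeff, coeff,
    toSeries_homog, toSeries_inOuter]
  by_cases hj : j = 1
  · subst hj
    simp only [twist_coeff, HahnSeries.coeff_single_same, invVar, MonoidHom.coe_mk, OneHom.coe_mk,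
      map_one, mul_one, MonoidHom.one_apply, toAdd_ofAdd, HahnSeries.coeff_one,
      HahnSeries.coeff_single]
    split_ifs <;> first | rfl | omega
  · simp [HahnSeries.coeff_single_of_ne hj]

end ScalarTwo

section Pairing

variable {U : Type*} [AddCommGroup U] [Module ℂ U]

/-- A linear form on `U`, applied to the coefficients of a series of `U((x))((y))`. -/
def pairing (μ : Module.Dual ℂ U) : LaurentTwo U →ₗ[ScalarTwo] ScalarTwo :=
  mapSeries (R := LaurentSeries ℂ) (mapSeries (R := ℂ) μ)

theorem coeff_pairing (μ : Module.Dual ℂ U) (s : LaurentTwo U) (i j : ℤ) :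
    (pairing μ s).coeff i j = μ (coeffTwo s i j) := rfl

end Pairing

/-! ### Expansions of rational functions -/

section Expansion

variable {K L : Type} [Field K] [Algebra ℂ K] [Field L] [Algebra ℂ L]

/-- As `ℂ` is algebraically closed, the only algebraic elements of an extension are constants. -/
theorem transcendental_of_forall_ne {y : K} (h : ∀ c : ℂ, algebraMap ℂ K c ≠ y) :
    Transcendental ℂ y := by
  intro ha
  have hi : IsIntegral ℂ y := ha.isIntegral
  have h1 : (minpoly ℂ y).degree = 1 :=
    IsAlgClosed.degree_eq_one_of_irreducible ℂ (minpoly.irreducible hi)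
  obtain ⟨c, hc⟩ := minpoly.mem_range_of_degree_eq_one ℂ y h1
  exact h c hc

theorem eval_denom_ne_zero {y : K} (hy : Transcendental ℂ y) (R : RatFunc ℂ) :
    Polynomial.eval₂ (algebraMap ℂ K) y R.denom ≠ 0 := fun h =>
  hy ⟨R.denom, R.denom_ne_zero, h⟩

/-- The value `R(y)` of a rational function `R` at a transcendental element `y` of a field, as a
homomorphism in `R`. -/
def ratEval (y : K) (hy : Transcendental ℂ y) : RatFunc ℂ →ₐ[ℂ] K where
  toFun := RatFunc.eval (algebraMap ℂ K) y
  map_one' := RatFunc.eval_one _ _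
  map_zero' := RatFunc.eval_zero _ _
  map_mul' R S := RatFunc.eval_mul _ _ (eval_denom_ne_zero hy R) (eval_denom_ne_zero hy S)
  map_add' R S := RatFunc.eval_add _ _ (eval_denom_ne_zero hy R) (eval_denom_ne_zero hy S)
  commutes' c := by
    rw [RatFunc.algebraMap_eq_C]
    exact RatFunc.eval_C _ _

theorem ratEval_apply {y : K} (hy : Transcendental ℂ y) (R : RatFunc ℂ) :
    ratEval y hy R = RatFunc.eval (algebraMap ℂ K) y R := rfl

@[simp]
theorem ratEval_X {y : K} (hy : Transcendental ℂ y) : ratEval y hy RatFunc.X = y :=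
  RatFunc.eval_X _ _

theorem ratEval_aeval_X {y : K} (hy : Transcendental ℂ y) (p : ℂ[X]) :
    ratEval y hy (aeval RatFunc.X p) = aeval y p := by
  rw [← aeval_algHom_apply, ratEval_X]

theorem ratEval_injective {y : K} (hy : Transcendental ℂ y) :
    Function.Injective (ratEval y hy) := (ratEval y hy : RatFunc ℂ →+* K).injective

theorem map_eval_ratFunc (φ : K →ₐ[ℂ] L) (y : K) (R : RatFunc ℂ) :
    φ (RatFunc.eval (algebraMap ℂ K) y R) = RatFunc.eval (algebraMap ℂ L) (φ y) R := by
  simp only [RatFunc.eval, map_div₀]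
  congr 1 <;>
  · rw [← RingHom.coe_coe φ, Polynomial.hom_eval₂]
    congr 1
    ext c
    simp

theorem Transcendental.inv' {y : K} (hy : Transcendental ℂ y) : Transcendental ℂ y⁻¹ :=
  fun h => hy (by simpa using h.inv)

theorem transcendental_X : Transcendental ℂ (RatFunc.X : RatFunc ℂ) := RatFunc.transcendental_X

/-- The substitution `X ↦ X⁻¹` in rational functions. -/
def reciprocal : RatFunc ℂ →ₐ[ℂ] RatFunc ℂ := ratEval RatFunc.X⁻¹ transcendental_X.inv'

theorem ratEval_reciprocal {y : K} (hy : Transcendental ℂ y) (R : RatFunc ℂ) :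
    ratEval y hy (reciprocal R) = ratEval y⁻¹ hy.inv' R := by
  rw [reciprocal, ratEval_apply transcendental_X.inv', map_eval_ratFunc, map_inv₀, ratEval_X,
    ← ratEval_apply]

end Expansion

theorem transcendental_laurentSeries {y : LaurentSeries ℂ} {n : ℤ} (hn : n ≠ 0)
    (h : y.coeff n ≠ 0) : Transcendental ℂ y := by
  refine transcendental_of_forall_ne fun c hc => h ?_
  rw [← hc, algebraMap_laurentSeries, HahnSeries.C_apply, HahnSeries.coeff_single_of_ne hn]

theorem expSeries_coeff (n : ℕ) : expSeries.coeff n = 1 / (n.factorial : ℂ) := by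
  rw [expSeries, HahnSeries.ofPowerSeries_apply_coeff, PowerSeries.coeff_exp]
  simp

theorem transcendental_expSeries : Transcendental ℂ expSeries :=
  transcendental_laurentSeries one_ne_zero (by have := expSeries_coeff 1; simp_all)

theorem transcendental_varT : Transcendental ℂ varT :=
  transcendental_laurentSeries one_ne_zero (by simp)

theorem varT_zpow (n : ℤ) : varT ^ n = HahnSeries.single n 1 := (RatFunc.single_zpow n).symm

theorem coeff_varT_zpow_mul (n : ℤ) (g : LaurentSeries ℂ) (j : ℤ) :
    (varT ^ n * g).coeff j = g.coeff (j - n) := by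
  rw [varT_zpow, HahnSeries.coeff_single_mul, one_mul]

/-! ### The substitutions `z ↦ -z` and `z ↦ log (1 + z)` -/

/-- The substitution `z ↦ -z` in `ℂ((z))`. -/
def negVar : LaurentSeries ℂ →ₐ[ℂ] LaurentSeries ℂ :=
  { (twist (RingHom.id ℂ)
      { toFun := fun k => (-1) ^ k.toAdd
        map_one' := by simp
        map_mul' := fun k l => by simp [zpow_add₀] } : LaurentSeries ℂ →+* LaurentSeries ℂ) with
    commutes' := fun c => by
      rw [algebraMap_laurentSeries]
      refine HahnSeries.ext (funext fun j => ?_)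
      change (-1) ^ j * (HahnSeries.C c : LaurentSeries ℂ).coeff j = _
      by_cases hj : j = 0
      · simp [hj]
      · simp [HahnSeries.C_apply, HahnSeries.coeff_single_of_ne hj] }

theorem negVar_coeff (g : LaurentSeries ℂ) (j : ℤ) :
    (negVar g).coeff j = (-1) ^ j * g.coeff j := rfl

theorem negVar_expSeries : negVar expSeries = expSeries⁻¹ := by
  have h1 : negVar expSeries
      = ((PowerSeries.evalNegHom (PowerSeries.exp ℂ) : PowerSeries ℂ) : LaurentSeries ℂ) := by
    ext j
    rw [negVar_coeff, expSeries, PowerSeries.coeff_coe, PowerSeries.coeff_coe]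
    split_ifs with hj
    · simp
    · obtain ⟨k, rfl⟩ := Int.eq_ofNat_of_zero_le (not_lt.1 hj)
      simp [PowerSeries.evalNegHom]
  refine eq_inv_of_mul_eq_one_right ?_
  rw [h1, expSeries, ← PowerSeries.coe_mul, PowerSeries.exp_mul_exp_neg_eq_one, PowerSeries.coe_one]

theorem logSeries_eq_coe : logSeries = (PowerSeries.log ℂ : LaurentSeries ℂ) := by
  rw [logSeries]
  congr 1
  ext n
  rw [PowerSeries.coeff_mk, PowerSeries.coeff_log]
  simp

theorem logSeries_ne_zero : logSeries ≠ 0 := by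
  obtain ⟨g, hg⟩ := logSeries_eq
  rw [hg]
  refine mul_ne_zero (HahnSeries.single_ne_zero one_ne_zero) fun h => g.ne_zero ?_
  exact HahnSeries.ofPowerSeries_injective (by rw [h, map_zero])

/-- The substitution `z ↦ log (1 + z)` in `ℂ[[z]]`, with values in `ℂ((z))`. -/
def logSubstPowerSeries : PowerSeries ℂ →+* LaurentSeries ℂ :=
  (HahnSeries.ofPowerSeries ℤ ℂ).comp
    (PowerSeries.substAlgHom (R := ℂ) (PowerSeries.HasSubst.log (A := ℂ)) :
      PowerSeries ℂ →+* PowerSeries ℂ)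

theorem isUnit_logSubstPowerSeries (y : Submonoid.powers (PowerSeries.X : PowerSeries ℂ)) :
    IsUnit (logSubstPowerSeries y) := by
  obtain ⟨_, n, rfl⟩ := y
  rw [isUnit_iff_ne_zero, map_pow]
  refine pow_ne_zero n ?_
  rw [logSubstPowerSeries, RingHom.comp_apply, RingHom.coe_coe, PowerSeries.substAlgHom_X,
    ← logSeries_eq_coe]
  exact logSeries_ne_zero

/-- The substitution `z ↦ log (1 + z)` in `ℂ((z))`. -/
def logSubst : LaurentSeries ℂ →+* LaurentSeries ℂ := IsLocalization.lift isUnit_logSubstPowerSeries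

theorem logSubst_coe (h : PowerSeries ℂ) :
    logSubst h = ((h.subst (PowerSeries.log ℂ) : PowerSeries ℂ) : LaurentSeries ℂ) := by
  have := IsLocalization.lift_eq (S := LaurentSeries ℂ) isUnit_logSubstPowerSeries h
  refine this.trans ?_
  change HahnSeries.ofPowerSeries ℤ ℂ
    (PowerSeries.substAlgHom (R := ℂ) PowerSeries.HasSubst.log h) = _
  rw [PowerSeries.coe_substAlgHom]

theorem logSubst_varT : logSubst varT = logSeries := by
  rw [varT, ← PowerSeries.coe_X, logSubst_coe,
    PowerSeries.subst_X (PowerSeries.HasSubst.log (A := ℂ)),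
    logSeries_eq_coe]

theorem logSubst_C (c : ℂ) : logSubst (HahnSeries.C c) = HahnSeries.C c := by
  rw [← PowerSeries.coe_C, logSubst_coe, PowerSeries.subst_C]
  rfl

/-- `E = exp (log (1 + z))` satisfies `(1 + z) E' = E`, so `E / (1 + z)` is constant. -/
theorem exp_subst_log :
    (PowerSeries.exp ℂ).subst (PowerSeries.log ℂ) = 1 + PowerSeries.X := by
  set E := (PowerSeries.exp ℂ).subst (PowerSeries.log ℂ) with hE
  set J : PowerSeries ℂ := PowerSeries.mk fun n => algebraMap ℚ ℂ ((-1 : ℚ) ^ n) with hJ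
  have h1 : (1 + PowerSeries.X) * J = 1 := by
    ext n
    cases n with
    | zero => simp [hJ, add_mul]
    | succ n => simp [hJ, add_mul, PowerSeries.coeff_succ_X_mul, pow_succ, PowerSeries.coeff_one]
  have hE' : PowerSeries.derivative ℂ E = E * J := by
    rw [hE, PowerSeries.derivative_subst (PowerSeries.HasSubst.log (A := ℂ)),
      PowerSeries.derivative_exp, PowerSeries.deriv_log]
  have hJ' : PowerSeries.derivative ℂ J = - (J * J) := by
    have := congrArg (PowerSeries.derivative ℂ) h1
    rw [Derivation.leibniz, map_add, PowerSeries.derivative_one, PowerSeries.derivative_X,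
      smul_eq_mul, smul_eq_mul] at this
    linear_combination J * this - PowerSeries.derivative ℂ J * h1
  have h0 : PowerSeries.constantCoeff E = 1 := by
    have : PowerSeries.constantCoeff (PowerSeries.exp ℂ - 1) = 0 := by simp
    have h2 := PowerSeries.constantCoeff_subst_eq_zero (a := PowerSeries.log ℂ)
      PowerSeries.constantCoeff_log (PowerSeries.exp ℂ - 1) this
    rw [PowerSeries.subst_sub (PowerSeries.HasSubst.log (A := ℂ))] at h2
    have h3 : (1 : PowerSeries ℂ).subst (PowerSeries.log ℂ) = (1 : PowerSeries ℂ) := by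
      rw [← PowerSeries.coe_substAlgHom (PowerSeries.HasSubst.log (A := ℂ)), map_one]
    rw [h3, ← hE] at h2
    have h4 : PowerSeries.constantCoeff (E - 1) = 0 := h2
    rw [map_sub, map_one, sub_eq_zero] at h4
    exact h4
  have hEJ : E * J = 1 := by
    refine PowerSeries.derivative.ext ?_ ?_
    · rw [Derivation.leibniz, hE', hJ', PowerSeries.derivative_one, smul_eq_mul, smul_eq_mul]
      ring
    · rw [map_mul, h0, one_mul, map_one]
      simp [hJ]
  linear_combination (1 + PowerSeries.X) * hEJ - E * h1

theorem logSubst_expSeries : logSubst expSeries = 1 + varT := by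
  rw [expSeries, logSubst_coe, exp_subst_log, PowerSeries.coe_add, PowerSeries.coe_one,
    PowerSeries.coe_X]

/-- `logSubst` as a homomorphism of algebras. -/
def logSubstHom : LaurentSeries ℂ →ₐ[ℂ] LaurentSeries ℂ :=
  { logSubst with
    commutes' := fun c => by
      rw [algebraMap_laurentSeries]
      exact logSubst_C c }

/-- A Laurent series, with its terms of degree `≥ M` collected. -/
theorem exists_eq_sum_add (g : LaurentSeries ℂ) (M : ℤ) :
    ∃ (s : Finset ℤ) (q : PowerSeries ℂ), (∀ m < M, m ∉ s → g.coeff m = 0) ∧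
      g = ∑ m ∈ s, HahnSeries.C (g.coeff m) * varT ^ m + varT ^ M * (q : LaurentSeries ℂ) := by
  refine ⟨Finset.Ico g.order M, PowerSeries.mk fun k => g.coeff (M + k), fun m hm hs => ?_, ?_⟩
  · exact HahnSeries.coeff_eq_zero_of_lt_order (by simp at hs; omega)
  · ext n
    have h1 : ∀ m : ℤ, (HahnSeries.C (g.coeff m) * varT ^ m).coeff n
        = if m = n then g.coeff m else 0 := by
      intro m
      rw [varT_zpow, HahnSeries.C_mul_eq_smul, HahnSeries.coeff_smul, HahnSeries.coeff_single]
      simp [eq_comm]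
    rw [HahnSeries.coeff_add, HahnSeries.coeff_sum, coeff_varT_zpow_mul,
      Finset.sum_congr rfl fun m _ => h1 m, Finset.sum_ite_eq', PowerSeries.coeff_coe]
    by_cases hn : n < M
    · rw [if_pos (by omega : n - M < 0), add_zero]
      split_ifs with h2
      · rfl
      · exact HahnSeries.coeff_eq_zero_of_lt_order (by simp at h2; omega)
    · rw [if_neg (by simp; omega), if_neg (by omega), zero_add, PowerSeries.coeff_mk]
      congr 1
      omega

/-- The terms of `g` of degree greater than `n` do not contribute to the coefficient of `z^n` in
`g(log (1 + z))`, so that only finitely many powers of the logarithm have to be summed. -/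
theorem logSubst_coeff (g : LaurentSeries ℂ) (n : ℤ) :
    (logSubst g).coeff n = ∑ᶠ m : ℤ, (logSeries ^ m).coeff n * g.coeff m := by
  obtain ⟨s, q, h1, h3⟩ := exists_eq_sum_add g (n + 1)
  have h4 : logSubst g = ∑ m ∈ s, HahnSeries.C (g.coeff m) * logSeries ^ m
      + logSeries ^ (n + 1)
        * ((q.subst (PowerSeries.log ℂ) : PowerSeries ℂ) : LaurentSeries ℂ) := by
    conv_lhs => rw [h3]
    simp only [map_add, map_sum, map_mul, map_zpow₀, logSubst_varT, logSubst_C, logSubst_coe]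
  have h5 : (logSeries ^ (n + 1)
      * ((q.subst (PowerSeries.log ℂ) : PowerSeries ℂ) : LaurentSeries ℂ)).coeff n = 0 := by
    rw [HahnSeries.coeff_mul]
    refine Finset.sum_eq_zero fun ij hij => ?_
    rw [Finset.mem_antidiagonal] at hij
    rcases lt_or_ge ij.1 (n + 1) with h | h
    · rw [coeff_logSeries_zpow h, zero_mul]
    · rw [PowerSeries.coeff_coe, if_pos (by omega), mul_zero]
  rw [h4, HahnSeries.coeff_add, h5, add_zero, HahnSeries.coeff_sum]
  rw [finsum_eq_sum_of_support_subset (s := s)]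
  · refine Finset.sum_congr rfl fun m _ => ?_
    rw [HahnSeries.C_mul_eq_smul, HahnSeries.coeff_smul, smul_eq_mul, mul_comm]
  · intro m hm
    by_contra hs
    refine hm ?_
    rcases lt_or_ge n m with h | h
    · simp only [coeff_logSeries_zpow h, zero_mul]
    · simp only [h1 m (by omega) hs, mul_zero]

/-! ### The two expansions of a power of `t - 1` -/

/-- Integer powers of a power series with constant term `1` are power series of the same kind. -/
theorem exists_coe_eq_zpow {q : PowerSeries ℂ} (hq : PowerSeries.constantCoeff q = 1) (k : ℤ) :
    ∃ p : PowerSeries ℂ, PowerSeries.constantCoeff p = 1 ∧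
      (q : LaurentSeries ℂ) ^ k = (p : LaurentSeries ℂ) := by
  have hinv : (q : LaurentSeries ℂ)⁻¹ = ((q⁻¹ : PowerSeries ℂ) : LaurentSeries ℂ) := by
    refine inv_eq_of_mul_eq_one_right ?_
    rw [← PowerSeries.coe_mul, PowerSeries.mul_inv_cancel q (by simp [hq]), PowerSeries.coe_one]
  obtain ⟨n, rfl | rfl⟩ := k.eq_nat_or_neg
  · exact ⟨q ^ n, by simp [hq], by rw [zpow_natCast, PowerSeries.coe_pow]⟩
  · refine ⟨q⁻¹ ^ n, by simp [hq], ?_⟩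
    rw [zpow_neg, zpow_natCast, ← inv_pow, hinv, PowerSeries.coe_pow]

/-- With `t = τ⁻¹`, the coefficient of `t^(-1-e)` in the difference of the expansions of
`(t - 1)^(-1-c)` at `t = ∞` and at `t = 0` is the coefficient of `z^c` in `(1 + z)^e`. -/
theorem coeff_expansion_sub (c e : ℤ) :
    ((1 - varT) ^ (-c - 1)).coeff (e - c) + (-1) ^ c * ((1 - varT) ^ (-c - 1)).coeff (-e - 1)
      = ((1 + varT) ^ e).coeff c := by
  have hne : (1 - varT) ≠ 0 := fun h => by
    have := congrArg (fun g => HahnSeries.coeff g 1) h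
    simp [HahnSeries.coeff_one] at this
  have hne' : (1 + varT) ≠ 0 := fun h => by
    have := congrArg (fun g => HahnSeries.coeff g 1) h
    simp [HahnSeries.coeff_one] at this
  have hmul : ∀ (g : LaurentSeries ℂ) (n : ℤ), (varT * g).coeff n = g.coeff (n - 1) := by
    intro g n
    rw [← zpow_one varT, coeff_varT_zpow_mul]
  -- Multiplication by `1 - τ` and by `z` give both sides the same difference equation.
  have hq : ∀ c k : ℤ, ((1 - varT) ^ (-(c - 1) - 1)).coeff k
      = ((1 - varT) ^ (-c - 1)).coeff k - ((1 - varT) ^ (-c - 1)).coeff (k - 1) := by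
    intro c k
    rw [show -(c - 1) - 1 = 1 + (-c - 1) by ring, zpow_add₀ hne, zpow_one, sub_mul, one_mul,
      HahnSeries.coeff_sub, hmul]
  have hr : ∀ c e : ℤ, ((1 + varT) ^ (e + 1)).coeff c
      = ((1 + varT) ^ e).coeff c + ((1 + varT) ^ e).coeff (c - 1) := by
    intro c e
    rw [add_comm e 1, zpow_add₀ hne', zpow_one, add_mul, one_mul, HahnSeries.coeff_add, hmul]
  have hsign : ∀ c : ℤ, (-1 : ℂ) ^ (c - 1) = - (-1) ^ c := by
    intro c
    rw [zpow_sub_one₀ (by norm_num)]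
    ring
  have hstep : ∀ c e : ℤ,
      ((1 - varT) ^ (-(c - 1) - 1)).coeff (e - (c - 1))
          + (-1) ^ (c - 1) * ((1 - varT) ^ (-(c - 1) - 1)).coeff (-e - 1)
        = (((1 - varT) ^ (-c - 1)).coeff (e + 1 - c)
            + (-1) ^ c * ((1 - varT) ^ (-c - 1)).coeff (-(e + 1) - 1))
          - (((1 - varT) ^ (-c - 1)).coeff (e - c)
            + (-1) ^ c * ((1 - varT) ^ (-c - 1)).coeff (-e - 1)) := by
    intro c e
    rw [hq, hq, hsign, show e - (c - 1) = e + 1 - c by ring,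
      show e + 1 - c - 1 = e - c by ring, show -(e + 1) - 1 = -e - 1 - 1 by ring]
    ring
  have hpow : ∀ k : ℤ, (∀ n < 0, ((1 - varT) ^ k).coeff n = 0) ∧ ((1 - varT) ^ k).coeff 0 = 1 := by
    intro k
    obtain ⟨p, hp, h⟩ := exists_coe_eq_zpow (q := 1 - PowerSeries.X) (by simp) k
    rw [PowerSeries.coe_sub, PowerSeries.coe_one, PowerSeries.coe_X] at h
    rw [h]
    exact ⟨fun n hn => by rw [PowerSeries.coeff_coe, if_pos hn], by simp [PowerSeries.coeff_coe, hp]⟩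
  have hpow' : ∀ k : ℤ, ∀ n < 0, ((1 + varT) ^ k).coeff n = 0 := by
    intro k n hn
    obtain ⟨p, hp, h⟩ := exists_coe_eq_zpow (q := 1 + PowerSeries.X) (by simp) k
    rw [PowerSeries.coe_add, PowerSeries.coe_one, PowerSeries.coe_X] at h
    rw [h, PowerSeries.coeff_coe, if_pos hn]
  revert e
  induction c using Int.inductionOn' (b := -1) with
  | zero =>
    intro e
    rw [hpow' e (-1) (by norm_num)]
    simp only [HahnSeries.coeff_one, neg_neg, sub_self, zpow_zero]
    split_ifs <;> first | omega | norm_num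
  | pred c _ ih =>
    intro e
    rw [hstep, ih, ih, hr]
    ring
  | succ c hc ih =>
    have h0 : ((1 - varT) ^ (-(c + 1) - 1)).coeff (0 - (c + 1))
        + (-1) ^ (c + 1) * ((1 - varT) ^ (-(c + 1) - 1)).coeff (-0 - 1)
        = ((1 + varT) ^ (0 : ℤ)).coeff (c + 1) := by
      rw [(hpow _).1 (-0 - 1) (by norm_num), mul_zero, add_zero, zpow_zero, HahnSeries.coeff_one]
      split_ifs with h
      · rw [h, sub_zero, (hpow _).2]
      · exact (hpow _).1 _ (by omega)
    have hd : ∀ e : ℤ, (((1 - varT) ^ (-(c + 1) - 1)).coeff (e + 1 - (c + 1))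
          + (-1) ^ (c + 1) * ((1 - varT) ^ (-(c + 1) - 1)).coeff (-(e + 1) - 1))
          - ((1 + varT) ^ (e + 1)).coeff (c + 1)
        = (((1 - varT) ^ (-(c + 1) - 1)).coeff (e - (c + 1))
          + (-1) ^ (c + 1) * ((1 - varT) ^ (-(c + 1) - 1)).coeff (-e - 1))
          - ((1 + varT) ^ e).coeff (c + 1) := by
      intro e
      have h1 := hstep (c + 1) e
      rw [add_sub_cancel_right, ih] at h1
      have h2 := hr (c + 1) e
      rw [add_sub_cancel_right] at h2
      linear_combination -h1 - h2
    intro e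
    rw [← sub_eq_zero]
    induction e using Int.induction_on with
    | zero => rw [sub_eq_zero]; exact h0
    | succ k ih' => rw [hd]; exact ih'
    | pred k ih' =>
      rw [← hd, sub_add_cancel]
      exact ih'

/-! ### Series that are regular in the outer variable -/

namespace ScalarTwo

/-- The inclusion `ℂ((x))[[y]] ⊂ ℂ((x))((y))`. -/
def ofRegular : PowerSeries (LaurentSeries ℂ) →+* ScalarTwo where
  toFun q := mk (HahnSeries.ofPowerSeries ℤ (LaurentSeries ℂ) q)
  map_one' := map_one (HahnSeries.ofPowerSeries ℤ (LaurentSeries ℂ))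
  map_mul' := map_mul (HahnSeries.ofPowerSeries ℤ (LaurentSeries ℂ))
  map_zero' := map_zero (HahnSeries.ofPowerSeries ℤ (LaurentSeries ℂ))
  map_add' := map_add (HahnSeries.ofPowerSeries ℤ (LaurentSeries ℂ))

theorem toSeries_ofRegular (q : PowerSeries (LaurentSeries ℂ)) :
    (ofRegular q).toSeries = HahnSeries.ofPowerSeries ℤ (LaurentSeries ℂ) q := rfl

theorem ofRegular_injective : Function.Injective ofRegular := fun _ _ h =>
  HahnSeries.ofPowerSeries_injective h

theorem coeff_ofRegular_of_neg (q : PowerSeries (LaurentSeries ℂ)) (i : ℤ) {j : ℤ} (hj : j < 0) :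
    (ofRegular q).coeff i j = 0 := by
  rw [coeff, toSeries_ofRegular, PowerSeries.coeff_coe, if_pos hj, HahnSeries.coeff_zero]

theorem coeff_ofRegular_natCast (q : PowerSeries (LaurentSeries ℂ)) (i : ℤ) (k : ℕ) :
    (ofRegular q).coeff i k = (PowerSeries.coeff k q).coeff i := by
  rw [coeff, toSeries_ofRegular, LaurentSeries.coeff_coe_powerSeries]

theorem coeff_ofRegular_zero (q : PowerSeries (LaurentSeries ℂ)) (i : ℤ) :
    (ofRegular q).coeff i 0 = (PowerSeries.constantCoeff q).coeff i := by
  rw [← Nat.cast_zero, coeff_ofRegular_natCast, PowerSeries.coeff_zero_eq_constantCoeff_apply]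

theorem exists_ofRegular {g : ScalarTwo} (h : ∀ i, ∀ j < 0, g.coeff i j = 0) :
    ∃ q, g = ofRegular q := by
  refine ⟨PowerSeries.mk fun k : ℕ => g.toSeries.coeff k, ?_⟩
  ext i j
  rcases lt_or_ge j 0 with hj | hj
  · rw [h i j hj, coeff_ofRegular_of_neg _ _ hj]
  · obtain ⟨k, rfl⟩ := Int.eq_ofNat_of_zero_le hj
    rw [coeff_ofRegular_natCast, PowerSeries.coeff_mk, coeff]

theorem ofRegular_inv {q : PowerSeries (LaurentSeries ℂ)} (hq : PowerSeries.constantCoeff q ≠ 0) :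
    (ofRegular q)⁻¹ = ofRegular q⁻¹ := by
  refine inv_eq_of_mul_eq_one_right ?_
  rw [← map_mul, PowerSeries.mul_inv_cancel q hq, map_one]

theorem ofRegular_C (g : LaurentSeries ℂ) : ofRegular (PowerSeries.C g) = inInner g :=
  HahnSeries.ofPowerSeries_C g

theorem ofRegular_map (p : PowerSeries ℂ) :
    ofRegular (p.map HahnSeries.C) = inOuter (p : LaurentSeries ℂ) := by
  refine HahnSeries.ext (funext fun j => ?_)
  change (ofRegular (p.map HahnSeries.C)).toSeries.coeff j
    = (inOuter (p : LaurentSeries ℂ)).toSeries.coeff j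
  rw [toSeries_ofRegular, toSeries_inOuter, twist_coeff, MonoidHom.one_apply, one_mul,
    PowerSeries.coeff_coe, PowerSeries.coeff_coe]
  split_ifs
  · rw [map_zero]
  · rw [PowerSeries.coeff_map]

theorem coeff_varOuter_zpow_mul (k : ℤ) (s : ScalarTwo) (i j : ℤ) :
    (varOuter ^ k * s).coeff i j = s.coeff i (j - k) := by
  rw [← slice_coeff, varOuter, inOuter_eq, ← map_zpow₀, ← inOuter_eq, slice_inOuter_mul,
    coeff_varT_zpow_mul, slice_coeff]

theorem varInner_sub_varOuter :
    varInner - varOuter = ofRegular (PowerSeries.C varT - PowerSeries.X) := by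
  rw [map_sub, ofRegular_C, varInner, varOuter, ← PowerSeries.map_X (HahnSeries.C),
    ofRegular_map, PowerSeries.coe_X]

theorem varT_ne_zero : varT ≠ 0 := HahnSeries.single_ne_zero one_ne_zero

theorem constantCoeff_C_varT_sub_X :
    PowerSeries.constantCoeff (PowerSeries.C varT - PowerSeries.X) = varT := by simp

theorem varInner_sub_varOuter_ne_zero : varInner - varOuter ≠ 0 := by
  rw [varInner_sub_varOuter, Ne, map_eq_zero_iff _ ofRegular_injective]
  intro h
  refine varT_ne_zero ?_
  rw [← constantCoeff_C_varT_sub_X, h, map_zero]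

/-! ### Transposition -/

/-- `g` in `ℂ((x))((y))` and `h` in `ℂ((y))((x))` are the same formal series in `x` and `y`. -/
def IsTranspose (g h : ScalarTwo) : Prop := ∀ i j, g.coeff i j = h.coeff j i

theorem IsTranspose.symm {g h : ScalarTwo} (H : IsTranspose g h) : IsTranspose h g :=
  fun i j => (H j i).symm

theorem IsTranspose.eq {g g' h : ScalarTwo} (H : IsTranspose g h) (H' : IsTranspose g' h) :
    g = g' := ext fun i j => (H i j).trans (H' i j).symm

theorem IsTranspose.add {g h g' h' : ScalarTwo} (H : IsTranspose g h) (H' : IsTranspose g' h') :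
    IsTranspose (g + g') (h + h') := fun i j => by
  rw [coeff_add, coeff_add, H, H']

theorem IsTranspose.sum {ι : Type*} (s : Finset ι) {g h : ι → ScalarTwo}
    (H : ∀ i ∈ s, IsTranspose (g i) (h i)) : IsTranspose (∑ i ∈ s, g i) (∑ i ∈ s, h i) := by
  classical
  induction s using Finset.induction_on with
  | empty => exact fun i j => by simp
  | insert a s ha ih =>
    rw [Finset.sum_insert ha, Finset.sum_insert ha]
    exact (H a (Finset.mem_insert_self a s)).add (ih fun i hi => H i (Finset.mem_insert_of_mem hi))

/-- Multiplication by `θ` in `ℂ((x))((y))` corresponds to multiplication by `θ'` in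
`ℂ((y))((x))`: the scalars `θ` and `θ'` are expansions of the same function. -/
def MulTranspose (θ θ' : ScalarTwo) : Prop :=
  ∀ g h, IsTranspose g h → IsTranspose (θ * g) (θ' * h)

theorem MulTranspose.symm {θ θ' : ScalarTwo} (H : MulTranspose θ θ') : MulTranspose θ' θ :=
  fun g h hgh => (H h g hgh.symm).symm

theorem MulTranspose.mul {θ θ' η η' : ScalarTwo} (H : MulTranspose θ θ') (H' : MulTranspose η η') :
    MulTranspose (θ * η) (θ' * η') := fun g h hgh => by
  rw [mul_assoc, mul_assoc]
  exact H _ _ (H' _ _ hgh)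

theorem MulTranspose.add {θ θ' η η' : ScalarTwo} (H : MulTranspose θ θ') (H' : MulTranspose η η') :
    MulTranspose (θ + η) (θ' + η') := fun g h hgh => by
  rw [add_mul, add_mul]
  exact (H _ _ hgh).add (H' _ _ hgh)

theorem mulTranspose_inInner (g : LaurentSeries ℂ) : MulTranspose (inInner g) (inOuter g) := by
  intro s h hs i j
  rw [coeff_inInner_mul, ← slice_coeff, slice_inOuter_mul]
  congr 2
  ext k
  exact hs k j

theorem inOuter_C (c : ℂ) : inOuter (HahnSeries.C c) = algebraMap ℂ ScalarTwo c := by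
  rw [inOuter_eq, ← algebraMap_laurentSeries, AlgHom.commutes]

theorem mulTranspose_algebraMap (c : ℂ) :
    MulTranspose (algebraMap ℂ ScalarTwo c) (algebraMap ℂ ScalarTwo c) := by
  have := mulTranspose_inInner (HahnSeries.C c)
  rw [inOuter_C] at this
  exact this

theorem MulTranspose.aeval {θ θ' : ScalarTwo} (H : MulTranspose θ θ') (p : ℂ[X]) :
    MulTranspose (aeval θ p) (aeval θ' p) := by
  induction p using Polynomial.induction_on with
  | C c => simpa using mulTranspose_algebraMap c
  | add p q hp hq => simpa using hp.add hq
  | monomial n c h => simpa [pow_succ, ← mul_assoc] using h.mul H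

theorem MulTranspose.pow {θ θ' : ScalarTwo} (H : MulTranspose θ θ') (n : ℕ) :
    MulTranspose (θ ^ n) (θ' ^ n) := by simpa using H.aeval (X ^ n)

theorem mulTranspose_sub : MulTranspose (varInner - varOuter) (varOuter - varInner) := by
  have h := (mulTranspose_inInner varT).add
    ((mulTranspose_algebraMap (-1)).mul (mulTranspose_inInner varT).symm)
  simpa [sub_eq_add_neg, varInner, varOuter] using h

/-- The exponential `e^x / e^y` of the difference of the two variables. -/
def expDiff : ScalarTwo := inInner expSeries / inOuter expSeries

theorem expDiff_eq : expDiff = inInner expSeries * inOuter expSeries⁻¹ := by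
  rw [expDiff, inOuter_eq, inOuter_eq, map_inv₀, div_eq_mul_inv]

theorem expDiff_inv : expDiff⁻¹ = inOuter expSeries / inInner expSeries := by
  rw [expDiff, inv_div]

theorem mulTranspose_expDiff : MulTranspose expDiff expDiff⁻¹ := by
  have h := (mulTranspose_inInner expSeries).mul (mulTranspose_inInner expSeries⁻¹).symm
  rw [← expDiff_eq] at h
  rwa [expDiff_inv, div_eq_mul_inv, inInner_eq expSeries, ← map_inv₀, ← inInner_eq]

theorem transcendental_expDiff : Transcendental ℂ expDiff := by
  refine transcendental_of_forall_ne fun c hc => ?_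
  have h1 : inOuter expSeries ≠ 0 := by
    rw [inOuter_eq, Ne, map_eq_zero]
    exact fun h => transcendental_expSeries (h ▸ isAlgebraic_zero)
  rw [expDiff, eq_div_iff h1] at hc
  have h2 := congrArg (fun g => coeff g 1 0) hc
  have h3 : (inInner expSeries).coeff 1 0 = 1 := by
    have := expSeries_coeff 1
    rw [Nat.cast_one] at this
    rw [coeff, toSeries_inInner, HahnSeries.C_apply, HahnSeries.coeff_single_same, this]
    simp
  have h4 : (algebraMap ℂ ScalarTwo c * inOuter expSeries).coeff 1 0 = 0 := by
    change (inInner (HahnSeries.C c) * inOuter expSeries).coeff 1 0 = 0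
    rw [coeff_inInner_mul, toSeries_inOuter, twist_coeff, MonoidHom.one_apply, one_mul,
      ← map_mul, HahnSeries.C_apply, HahnSeries.coeff_single_of_ne one_ne_zero]
  simp only [h3, h4] at h2
  exact zero_ne_one h2

theorem exists_ofRegular_expDiff :
    ∃ q, expDiff = ofRegular q ∧ PowerSeries.constantCoeff q = expSeries := by
  have h : PowerSeries.constantCoeff ((PowerSeries.exp ℂ).map (HahnSeries.C (Γ := ℤ))) = 1 := by
    rw [← PowerSeries.coeff_zero_eq_constantCoeff_apply, PowerSeries.coeff_map]
    simp
  refine ⟨PowerSeries.C expSeries * ((PowerSeries.exp ℂ).map HahnSeries.C)⁻¹, ?_, ?_⟩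
  · rw [map_mul, ← ofRegular_inv (by rw [h]; exact one_ne_zero), ofRegular_C, ofRegular_map,
      expDiff, div_eq_mul_inv, expSeries]
  · rw [map_mul, PowerSeries.constantCoeff_inv, h]
    simp

theorem exists_ofRegular_aeval_expDiff (p : ℂ[X]) :
    ∃ q, aeval expDiff p = ofRegular q ∧ PowerSeries.constantCoeff q = aeval expSeries p := by
  obtain ⟨q, hq, hq'⟩ := exists_ofRegular_expDiff
  refine ⟨eval₂ ((PowerSeries.C (R := LaurentSeries ℂ)).comp HahnSeries.C) q p, ?_, ?_⟩
  · rw [Polynomial.hom_eval₂, ← hq, aeval_def]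
    congr 1
    ext1 c
    rw [RingHom.comp_apply, RingHom.comp_apply, ofRegular_C]
    rfl
  · rw [Polynomial.hom_eval₂, hq', aeval_def]
    congr 1
    ext1 c
    rw [algebraMap_laurentSeries]
    simp

end ScalarTwo

/-! ### Matrix coefficients of vertex operators -/

section MatrixCoeff

variable {V W : Type*} [AddCommGroup V] [Module ℂ V] [AddCommGroup W] [Module ℂ W]

theorem coeffTwo_prodOp (a b : VertexOperator ℂ W) (w : W) (i j : ℤ) :
    coeffTwo (prodOp a b w) i j = coeffOne (a (coeffOne (b w) j)) i := rfl

theorem coeffTwo_iterOp (Y : V →ₗ[ℂ] VertexOperator ℂ W) (s : HahnModule ℤ ℂ V) (w : W)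
    (i j : ℤ) : coeffTwo (iterOp Y s w) i j = coeffOne (Y (coeffOne s j) w) i := rfl

theorem pairing_revProd (μ : Module.Dual ℂ W) (Y : V →ₗ[ℂ] VertexOperator ℂ W) {r : ℕ}
    (g : Fin r → ScalarTwo) (u' v' : Fin r → V) (w : W) :
    pairing μ (revProd Y g u' v' w) = ∑ i, g i * pairing μ (prodOp (Y (v' i)) (Y (u' i)) w) := by
  simp only [revProd, map_sum, map_smul, smul_eq_mul]

/-- The linear form `a ↦ μ(Y(a, x) w)_n`, where `n` is the exponent of `x`. -/
def matrixCoeff (Y : V →ₗ[ℂ] VertexOperator ℂ W) (μ : Module.Dual ℂ W) (w : W) (n : ℤ) :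
    Module.Dual ℂ V where
  toFun a := μ (coeffOne (Y a w) n)
  map_add' a b := by
    rw [map_add, LinearMap.add_apply, ← map_add]
    rfl
  map_smul' c a := by
    rw [LinearMap.map_smul Y, LinearMap.smul_apply, RingHom.id_apply]
    exact μ.map_smul c (coeffOne (Y a w) n)

theorem slice_pairing_iterOp (Y : V →ₗ[ℂ] VertexOperator ℂ W) (μ : Module.Dual ℂ W)
    (s : HahnModule ℤ ℂ V) (w : W) (n : ℤ) :
    slice n (pairing μ (iterOp Y s w)) = mapSeries (matrixCoeff Y μ w n) s := rfl

end MatrixCoeff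

/-! ### Skew symmetry -/

theorem jacobiDelta_regular (b : ℤ) : ∃ q, jacobiDelta b = ofRegular q := ⟨_, rfl⟩

theorem shiftSub_regular (f : LaurentSeries ℂ) : ∃ q, shiftSub f = ofRegular q := ⟨_, rfl⟩

/-- `x₂⁻¹ δ((x₁ - x₀)/x₂)` has `(x₂ + x₀)⁻¹` as its coefficient of `x₁^0`. -/
theorem jacobiDelta_zero_eq : jacobiDelta 0 = varInner ^ (-1 : ℤ) *
    homog ((PowerSeries.mk fun k => (-1 : ℂ) ^ k : PowerSeries ℂ) : LaurentSeries ℂ) := by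
  ext i j
  rw [coeff_varInner_zpow_mul, ScalarTwo.coeff, ScalarTwo.coeff, toSeries_homog, twist_coeff]
  change ((HahnSeries.ofPowerSeries ℤ (LaurentSeries ℂ) _).coeff j).coeff i = _
  rw [PowerSeries.coeff_coe, PowerSeries.coeff_coe]
  split_ifs with hj
  · simp
  · obtain ⟨k, rfl⟩ := Int.eq_ofNat_of_zero_le (not_lt.1 hj)
    have hc : Ring.choose (k : ℤ) k = 1 := by
      rw [Ring.choose_natCast, Nat.choose_self, Nat.cast_one]
    simp only [Int.natAbs_natCast, PowerSeries.coeff_mk, zero_add, hc, Int.cast_one, mul_one,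
      invVar, MonoidHom.coe_mk, OneHom.coe_mk, toAdd_ofAdd, HahnSeries.C_apply,
      HahnSeries.single_mul_single, add_zero, one_mul, HahnSeries.coeff_single]
    split_ifs <;> first | rfl | omega

/-- For `g(x₂, x₀)` without negative powers of `x₂`, the coefficients of `(x₂ + x₀)⁻¹ g(x₂, x₀)` in
which the power of `x₂` is negative are, up to sign, those of `g(x, -x)`. -/
theorem coeff_jacobiDelta_zero_mul (g : ScalarTwo) (c a : ℤ) (hca : c ≤ a)
    (hg : ∀ i < 0, ∀ j, g.coeff i j = 0) :
    (jacobiDelta 0 * g).coeff (c - 1 - a) a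
      = (-1) ^ a * ∑ᶠ j : ℤ, (-1) ^ j * g.coeff (c - j) j := by
  have h : (jacobiDelta 0 * g).coeff (c - 1 - a) a
      = (((PowerSeries.mk fun k => (-1 : ℂ) ^ k : PowerSeries ℂ) : LaurentSeries ℂ)
          * diag c g).coeff a := by
    rw [← diag_homog_mul, diag_coeff, jacobiDelta_zero_eq, mul_assoc, coeff_varInner_zpow_mul]
    congr 1
    ring
  rw [h, coeff_mul_eq_finsum, mul_finsum]
  refine finsum_congr fun j => ?_
  rw [diag_coeff]
  rcases lt_or_ge a j with hj | hj
  · rw [hg (c - j) (by omega)]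
    simp
  · rw [PowerSeries.coeff_coe, if_neg (by omega), PowerSeries.coeff_mk]
    obtain ⟨k, rfl⟩ : ∃ k : ℕ, a = j + k := ⟨(a - j).toNat, by omega⟩
    rw [add_sub_cancel_left, Int.natAbs_natCast, zpow_add₀ (by norm_num), zpow_natCast]
    have h2 : (-1 : ℂ) ^ j * (-1) ^ j = 1 := by rw [← mul_zpow]; simp
    linear_combination -((-1) ^ k * g.coeff (c - j) j) * h2

section Skew

variable {V : Type*} [AddCommGroup V] [Module ℂ V] (A : WeakQuantumVertexAlgebra V)

/-- By the creation property `Y(a, x₁) Y(b, x₂) 𝟏` has no negative powers of `x₂`, and it equals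
`Y(a, x₁) b` at `x₂ = 0`. -/
theorem prodOp_vac_regular (μ : Module.Dual ℂ V) (a b : V) :
    ∃ q, pairing μ (prodOp (A.Y a) (A.Y b) A.vac) = ofRegular q ∧
      PowerSeries.constantCoeff q = mapSeries μ (A.Y a b) := by
  obtain ⟨q, hq⟩ := exists_ofRegular (g := pairing μ (prodOp (A.Y a) (A.Y b) A.vac))
    fun i j hj => by
      rw [coeff_pairing, coeffTwo_prodOp, A.creation b j hj, map_zero]
      exact map_zero μ
  refine ⟨q, hq, ?_⟩
  ext i
  rw [← coeff_ofRegular_zero, ← hq, coeff_pairing, coeffTwo_prodOp, A.creation_zero]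
  rfl

/-- The part of the `S`-Jacobi identity on the vacuum that is needed: paired with `μ`, the series
`Y(a, x₁) Y(b, x₂) 𝟏` agrees, up to multiplication by powers of `x₂ - x₁`, with a series `ρ` that is
regular in `x₁`, and `ρ` at `x₁ = 0`, `x₂ = x` is `Y(Y(a, -x) b, x) 𝟏`. The latter is read off from
the coefficients of `x₁^0 x₀^m` with `m` large. -/
theorem exists_opposite (μ : Module.Dual ℂ V) (a b : V) :
    ∃ ρ : PowerSeries (LaurentSeries ℂ), (∃ N : ℕ, ∀ M ≥ N,
      IsTranspose ((varInner - varOuter) ^ M * ofRegular ρ)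
        ((varOuter - varInner) ^ M * pairing μ (prodOp (A.Y a) (A.Y b) A.vac))) ∧
      ∀ c : ℤ, (PowerSeries.constantCoeff ρ).coeff c
        = ∑ᶠ j : ℤ, (-1) ^ j * μ (coeffTwo (iterOp A.Y (A.Y a b) A.vac) (c - j) j) := by
  obtain ⟨r, a', b', f, hJ⟩ := A.jacobi a b
  set σ := pairing μ (prodOp (A.Y a) (A.Y b) A.vac) with hσ
  set ι := pairing μ (iterOp A.Y (A.Y a b) A.vac) with hι
  obtain ⟨s, hs, -⟩ := prodOp_vac_regular A μ a b
  rw [← hσ] at hs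
  obtain ⟨ρ, hρ⟩ : ∃ ρ, pairing μ (revProd A.Y (fun i => shiftSub (f i)) a' b' A.vac)
      = ofRegular ρ := by
    choose q hq _ using fun i => prodOp_vac_regular A μ (b' i) (a' i)
    choose p hp using fun i => shiftSub_regular (f i)
    refine ⟨∑ i, p i * q i, ?_⟩
    rw [pairing_revProd, map_sum]
    exact Finset.sum_congr rfl fun i _ => by rw [map_mul, hq, hp]
  have key : ∀ m b c : ℤ, ((varInner - varOuter) ^ (-m - 1) * σ).coeff b c
      - ((-1) ^ (-m - 1) * (varInner - varOuter) ^ (-m - 1) * ofRegular ρ).coeff c b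
      = (jacobiDelta b * ι).coeff c m := by
    intro m b c
    have h := congrArg μ (hJ A.vac m b c)
    rw [map_sub, ← coeff_pairing, ← coeff_pairing, ← coeff_pairing, map_smul, map_smul, map_smul,
      hρ] at h
    exact h
  have hinner : ∀ i < 0, ∀ j, ι.coeff i j = 0 := by
    intro i hi j
    rw [hι, coeff_pairing, coeffTwo_iterOp, A.creation _ i hi, map_zero]
  refine ⟨ρ, ?_, fun c => ?_⟩
  · -- `x₀^m` does not occur in `Y(a, x₀) b` when `m` is below the order of that series.
    set n := ((HahnModule.of ℂ).symm (A.Y a b)).order with hn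
    obtain ⟨q, hq⟩ : ∃ q, ι = varOuter ^ n * ofRegular q := by
      obtain ⟨q, hq⟩ := exists_ofRegular (g := varOuter ^ (-n) * ι) fun i j hj => by
        have h0 : coeffOne (A.Y a b) (j - -n) = 0 :=
          HahnSeries.coeff_eq_zero_of_lt_order (by omega)
        rw [coeff_varOuter_zpow_mul, hι, coeff_pairing, coeffTwo_iterOp, h0, map_zero,
          LinearMap.zero_apply]
        exact map_zero μ
      exact ⟨q, by rw [← hq, ← mul_assoc, ← zpow_add₀ varOuter_ne_zero, add_neg_cancel,
        zpow_zero, one_mul]⟩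
    refine ⟨(-n).toNat, fun M hM i j => ?_⟩
    have h := key (-M - 1) j i
    obtain ⟨p, hp⟩ := jacobiDelta_regular j
    rw [hq, hp, mul_left_comm, ← map_mul, coeff_varOuter_zpow_mul,
      coeff_ofRegular_of_neg _ _ (by omega), sub_eq_zero,
      show -(-(M : ℤ) - 1) - 1 = M by ring, zpow_natCast, zpow_natCast] at h
    have hsign : (varOuter - varInner) ^ M = (-1) ^ M * (varInner - varOuter) ^ M := by
      rw [← mul_pow]
      congr 1
      ring
    have h1 : (algebraMap ℂ ScalarTwo (-1)) ^ M = (-1) ^ M := by simp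
    have h2 : ∀ (g : ScalarTwo) (i j : ℤ), ((-1) ^ M * g).coeff i j = (-1) ^ M * g.coeff i j := by
      intro g i j
      rw [← h1, ← map_pow, ScalarTwo.algebraMap_eq]
      change (inInner (HahnSeries.C ((-1) ^ M)) * g).coeff i j = _
      rw [coeff_inInner_mul, HahnSeries.C_mul_eq_smul, HahnSeries.coeff_smul, smul_eq_mul]
      rfl
    rw [hsign, mul_assoc, h2, h, mul_assoc, h2, ← mul_assoc, ← mul_pow]
    simp
  · -- In degree `0` in `x₁` and negative degree in `x₂`, the first term has no coefficient.
    have hunit : PowerSeries.constantCoeff (PowerSeries.C varT - PowerSeries.X) ≠ 0 := by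
      rw [constantCoeff_C_varT_sub_X]
      exact varT_ne_zero
    have h := key c.toNat 0 (c - 1 - c.toNat)
    have hpow : (varInner - varOuter) ^ (-(c.toNat : ℤ) - 1)
        = ofRegular ((PowerSeries.C varT - PowerSeries.X)⁻¹ ^ (c.toNat + 1)) := by
      rw [varInner_sub_varOuter, map_pow, ← ofRegular_inv hunit, inv_pow, ← zpow_natCast,
        ← zpow_neg]
      congr 1
      push_cast
      ring
    rw [coeff_jacobiDelta_zero_mul _ _ _ (by omega) hinner, hpow, hs, ← map_mul,
      coeff_ofRegular_of_neg _ _ (by omega), zero_sub] at h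
    obtain ⟨ε, hε⟩ : ∃ ε : ℂ, ε = (-1) ^ (c.toNat + 1) := ⟨_, rfl⟩
    have hsign : ((-1 : ScalarTwo)) ^ (-(c.toNat : ℤ) - 1)
        = ofRegular (PowerSeries.C (HahnSeries.C ε)) := by
      rw [ofRegular_C, show -(c.toNat : ℤ) - 1 = -((c.toNat + 1 : ℕ) : ℤ) by push_cast; ring,
        zpow_neg, zpow_natCast, ← inv_pow, inv_neg_one, hε, inInner_eq, map_pow, map_pow, map_neg,
        map_neg, map_one, map_one]
    rw [hsign, ← map_mul, ← map_mul, coeff_ofRegular_zero, map_mul, map_mul, map_pow,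
      PowerSeries.constantCoeff_inv, constantCoeff_C_varT_sub_X, PowerSeries.constantCoeff_C,
      mul_assoc, HahnSeries.C_mul_eq_smul, HahnSeries.coeff_smul, inv_pow, ← zpow_natCast,
      ← zpow_neg, coeff_varT_zpow_mul, smul_eq_mul,
      show c - 1 - (c.toNat : ℤ) - -((c.toNat + 1 : ℕ) : ℤ) = c by push_cast; ring,
      zpow_natCast, hε, pow_succ] at h
    have hne : (-1 : ℂ) ^ c.toNat ≠ 0 := pow_ne_zero _ (by norm_num)
    refine mul_left_cancel₀ hne (Eq.trans ?_ h)
    ring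

theorem exists_common_denominator {r : ℕ} (f : Fin r → RatFunc ℂ) :
    ∃ (D : ℂ[X]) (n : Fin r → ℂ[X]), D ≠ 0 ∧
      ∀ i, aeval RatFunc.X D * f i = aeval RatFunc.X (n i) := by
  obtain ⟨D, hD⟩ := IsLocalization.exist_integer_multiples_of_finite (nonZeroDivisors ℂ[X]) f
  choose n hn using hD
  refine ⟨D, n, nonZeroDivisors.ne_zero D.2, fun i => ?_⟩
  rw [RatFunc.aeval_X_left_eq_algebraMap, RatFunc.aeval_X_left_eq_algebraMap, hn i,
    Algebra.smul_def]

/-- Skew symmetry: `Y(u, z) v = ∑ f_i(e^z) Y(Y(v⁽ⁱ⁾, -z) u⁽ⁱ⁾, z) 𝟏`, paired with `μ`. -/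
theorem skew_symmetry (μ : Module.Dual ℂ V) {u v : V} {r : ℕ} {u' v' : Fin r → V}
    {f : Fin r → RatFunc ℂ} {k : ℕ} (h : TrigLocality A u v u' v' f k) :
    ∃ E : Fin r → LaurentSeries ℂ,
      (∀ i c, (E i).coeff c = ∑ᶠ j : ℤ, (-1) ^ j *
        μ (coeffTwo (iterOp A.Y (A.Y (v' i) (u' i)) A.vac) (c - j) j)) ∧
      mapSeries μ (A.Y u v) = ∑ i, ratEval expSeries transcendental_expSeries (f i) * E i := by
  obtain ⟨D, n, hD, hn⟩ := exists_common_denominator f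
  choose ρ hρ hE using fun i => exists_opposite A μ (v' i) (u' i)
  choose N hN using hρ
  refine ⟨fun i => PowerSeries.constantCoeff (ρ i), hE, ?_⟩
  obtain ⟨T, hT, hT0⟩ := prodOp_vac_regular A μ u v
  set M := ∑ i, N i with hM
  have hNM : ∀ i, N i ≤ M := fun i => Finset.single_le_sum (fun _ _ => zero_le) (Finset.mem_univ i)
  have hloc : IsTranspose ((varInner - varOuter) ^ k * ofRegular T)
      ((varOuter - varInner) ^ k * ∑ i, ratEval expDiff⁻¹ transcendental_expDiff.inv' (f i)
        * pairing μ (prodOp (A.Y (v' i)) (A.Y (u' i)) A.vac)) := by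
    intro b c
    have h1 := congrArg μ (h A.vac b c)
    rw [← coeff_pairing, ← coeff_pairing, map_smul, map_smul, pairing_revProd, hT] at h1
    simp only [ratEval_apply, expDiff_inv]
    exact h1
  have hleft := (mulTranspose_sub.pow M).mul (mulTranspose_expDiff.aeval D) _ _ hloc
  have hright : IsTranspose
      (∑ i, (varInner - varOuter) ^ k * aeval expDiff (n i)
        * ((varInner - varOuter) ^ M * ofRegular (ρ i)))
      (∑ i, (varOuter - varInner) ^ k * aeval expDiff⁻¹ (n i)
        * ((varOuter - varInner) ^ M * pairing μ (prodOp (A.Y (v' i)) (A.Y (u' i)) A.vac))) :=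
    IsTranspose.sum _ fun i _ =>
      (mulTranspose_sub.pow k).mul (mulTranspose_expDiff.aeval (n i)) _ _ (hN i M (hNM i))
  have hsame : (varOuter - varInner) ^ M * aeval expDiff⁻¹ D *
        ((varOuter - varInner) ^ k * ∑ i, ratEval expDiff⁻¹ transcendental_expDiff.inv' (f i)
          * pairing μ (prodOp (A.Y (v' i)) (A.Y (u' i)) A.vac))
      = ∑ i, (varOuter - varInner) ^ k * aeval expDiff⁻¹ (n i)
        * ((varOuter - varInner) ^ M * pairing μ (prodOp (A.Y (v' i)) (A.Y (u' i)) A.vac)) := by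
    rw [Finset.mul_sum, Finset.mul_sum]
    refine Finset.sum_congr rfl fun i _ => ?_
    rw [← ratEval_aeval_X transcendental_expDiff.inv' (n i), ← hn, map_mul, ratEval_aeval_X]
    ring
  rw [hsame] at hleft
  have heq := hleft.eq hright
  have hne : (varInner - varOuter) ^ M * (varInner - varOuter) ^ k ≠ 0 :=
    mul_ne_zero (pow_ne_zero _ varInner_sub_varOuter_ne_zero)
      (pow_ne_zero _ varInner_sub_varOuter_ne_zero)
  have heq2 : aeval expDiff D * ofRegular T = ∑ i, aeval expDiff (n i) * ofRegular (ρ i) := by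
    refine mul_left_cancel₀ hne ?_
    rw [Finset.mul_sum]
    refine Eq.trans ?_ (heq.trans (Finset.sum_congr rfl fun i _ => ?_)) <;> ring
  -- Both sides are regular in the outer variable, which is now set equal to `0`.
  obtain ⟨d, hd, hd0⟩ := exists_ofRegular_aeval_expDiff D
  choose m hm hm0 using fun i => exists_ofRegular_aeval_expDiff (n i)
  have heq3 : d * T = ∑ i, m i * ρ i := by
    refine ofRegular_injective ?_
    rw [map_mul, map_sum, ← hd, heq2]
    exact Finset.sum_congr rfl fun i _ => by rw [map_mul, hm]
  have heq4 := congrArg PowerSeries.constantCoeff heq3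
  rw [map_mul, map_sum, hd0, hT0] at heq4
  have hDe : aeval expSeries D ≠ 0 := fun h0 => transcendental_expSeries ⟨D, hD, h0⟩
  refine mul_left_cancel₀ hDe (heq4.trans ?_)
  rw [Finset.mul_sum]
  refine Finset.sum_congr rfl fun i _ => ?_
  rw [map_mul, hm0, ← ratEval_aeval_X transcendental_expSeries (n i), ← hn, map_mul,
    ratEval_aeval_X, mul_assoc]

end Skew

/-! ### Matrix coefficients on the module are rational functions -/

theorem varInner_div_varOuter : varInner / varOuter = homog varT⁻¹ := by
  rw [map_inv₀, homog_varT, inv_div]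

theorem varInner_sub_varOuter_zpow (k : ℤ) :
    (varInner - varOuter) ^ k = varInner ^ k * homog ((1 - varT) ^ k) := by
  rw [map_zpow₀, ← mul_zpow, map_sub, map_one, homog_varT, mul_sub, mul_one,
    mul_div_cancel₀ _ varInner_ne_zero]

theorem coeff_sum_C_mul (s : Finset ℤ) (G : ℤ → ℂ) (g : ℤ → LaurentSeries ℂ) (j : ℤ) :
    (∑ i ∈ s, HahnSeries.C (G i) * g i).coeff j = ∑ i ∈ s, G i * (g i).coeff j := by
  rw [HahnSeries.coeff_sum]
  refine Finset.sum_congr rfl fun i _ => ?_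
  rw [HahnSeries.C_mul_eq_smul, HahnSeries.coeff_smul, smul_eq_mul]

section Module

variable {V W : Type*} [AddCommGroup V] [Module ℂ V] [AddCommGroup W] [Module ℂ W]
  {A : WeakQuantumVertexAlgebra V} (M : PhiCoordinatedQuasiModule A W)

theorem ratEval_laurent {y : LaurentSeries ℂ} (hy : Transcendental ℂ y) (s : Finset ℤ)
    (G : ℤ → ℂ) :
    ratEval y hy (∑ i ∈ s, algebraMap ℂ (RatFunc ℂ) (G i) * RatFunc.X ^ i)
      = ∑ i ∈ s, HahnSeries.C (G i) * y ^ i := by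
  rw [map_sum]
  refine Finset.sum_congr rfl fun i _ => ?_
  rw [map_mul, map_zpow₀, ratEval_X, AlgHom.commutes, algebraMap_laurentSeries]

/-- Each homogeneous matrix coefficient of `Y_W(u, x₁) Y_W(v, x)` is the expansion at `t = ∞`,
where `t = x₁/x`, of a rational function `R(t)`, whose value at `t = e^z` is the corresponding
coefficient of `Y_W(Y(u, z)v, x)`. The denominator `p` of `R` does not depend on the matrix
coefficient. -/
theorem exists_rational (u v : V) : ∃ p : ℂ[X], p ≠ 0 ∧
    ∀ (w : W) (μ : Module.Dual ℂ W) (n : ℤ), ∃ R : RatFunc ℂ,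
      (∃ (s : Finset ℤ) (G : ℤ → ℂ), aeval RatFunc.X p * R
        = ∑ i ∈ s, algebraMap ℂ (RatFunc ℂ) (G i) * RatFunc.X ^ i) ∧
      diag n (pairing μ (prodOp (M.Y u) (M.Y v) w))
        = varT ^ n * ratEval varT⁻¹ transcendental_varT.inv' R ∧
      slice n (pairing μ (iterOp M.Y (A.Y u v) w))
        = ratEval expSeries transcendental_expSeries R := by
  obtain ⟨p, hp, H⟩ := M.assoc u v
  refine ⟨p, hp, fun w μ n => ?_⟩
  obtain ⟨⟨N, hN⟩, hsub⟩ := H w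
  set B := coeffTwo (aeval (varInner / varOuter) p • prodOp (M.Y u) (M.Y v) w) with hB
  have hp' : (aeval RatFunc.X p : RatFunc ℂ) ≠ 0 := fun h => transcendental_X ⟨p, hp, h⟩
  set s := Finset.Icc N (n - N) with hs
  have hG : ∀ i ∉ s, B i (n - i) = 0 := fun i hi => hN _ _ (by simp [hs] at hi; omega)
  set L : RatFunc ℂ := ∑ i ∈ s, algebraMap ℂ (RatFunc ℂ) (μ (B i (n - i))) * RatFunc.X ^ i with hL
  have hR : aeval RatFunc.X p * (L / aeval RatFunc.X p) = L := mul_div_cancel₀ _ hp'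
  refine ⟨L / aeval RatFunc.X p, ⟨s, _, hR⟩, ?_, ?_⟩
  · have hne : aeval varT⁻¹ p ≠ 0 := fun h => transcendental_varT.inv' ⟨p, hp, h⟩
    refine mul_left_cancel₀ hne ?_
    rw [mul_left_comm, ← ratEval_aeval_X transcendental_varT.inv', ← map_mul, hR,
      ratEval_aeval_X, ← diag_homog_mul, ← aeval_algHom_apply, ← varInner_div_varOuter,
      ← smul_eq_mul, ← map_smul, hL, ratEval_laurent, Finset.mul_sum]
    ext j
    rw [diag_coeff, coeff_pairing, ← hB, Finset.sum_congr rfl fun i _ => mul_left_comm _ _ _,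
      coeff_sum_C_mul]
    have h1 : ∀ i : ℤ, (varT ^ n * varT⁻¹ ^ i).coeff j = if n - j = i then 1 else 0 := by
      intro i
      rw [inv_zpow', varT_zpow (-i), HahnSeries.coeff_mul_single, mul_one, varT_zpow]
      rw [HahnSeries.coeff_single]
      split_ifs <;> first | rfl | omega
    simp only [h1, mul_ite, mul_one, mul_zero, Finset.sum_ite_eq]
    split_ifs with h2
    · rw [sub_sub_cancel]
    · have := hG _ h2
      rw [sub_sub_cancel] at this
      rw [this, map_zero]
  · have hne : aeval expSeries p ≠ 0 := fun h => transcendental_expSeries ⟨p, hp, h⟩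
    refine mul_left_cancel₀ hne ?_
    rw [← ratEval_aeval_X transcendental_expSeries, ← map_mul, hR,
      ratEval_aeval_X, ← slice_inOuter_mul, inOuter_eq, ← aeval_algHom_apply, ← inOuter_eq,
      ← smul_eq_mul, ← map_smul, hL, ratEval_laurent]
    ext c
    rw [slice_coeff, coeff_pairing, hsub, coeff_sum_C_mul, substExpCoeff,
      finsum_eq_sum_of_support_subset (s := s), map_sum]
    · refine Finset.sum_congr rfl fun i _ => ?_
      rw [map_smul, smul_eq_mul, mul_comm]
    · intro i hi
      by_contra h
      exact hi (by simp only [hG i h, smul_zero])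

/-- `Y_W(Y(a, z) 𝟏, x) = Y_W(a, x e^z)`. -/
theorem slice_iterOp_vac (a : V) (w : W) (μ : Module.Dual ℂ W) (n : ℤ) :
    slice n (pairing μ (iterOp M.Y (A.Y a A.vac) w))
      = expSeries ^ n * HahnSeries.C (matrixCoeff M.Y μ w n a) := by
  obtain ⟨p, -, H⟩ := exists_rational M a A.vac
  obtain ⟨R, -, hdiag, hslice⟩ := H w μ n
  have h1 : diag n (pairing μ (prodOp (M.Y a) (M.Y A.vac) w))
      = HahnSeries.C (matrixCoeff M.Y μ w n a) := by
    ext j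
    rw [diag_coeff, coeff_pairing, coeffTwo_prodOp, M.Y_vac]
    by_cases hj : j = 0
    · subst hj
      rw [HahnSeries.C_apply, HahnSeries.coeff_single_same, sub_zero]
      change μ (coeffOne (M.Y a ((HahnSeries.single 0 w).coeff 0)) n) = _
      rw [HahnSeries.coeff_single_same]
      rfl
    · rw [HahnSeries.C_apply, HahnSeries.coeff_single_of_ne hj]
      change μ (coeffOne (M.Y a ((HahnSeries.single 0 w).coeff j)) (n - j)) = _
      rw [HahnSeries.coeff_single_of_ne hj, map_zero]
      exact map_zero μ
  have h2 : R = algebraMap ℂ (RatFunc ℂ) (matrixCoeff M.Y μ w n a) * RatFunc.X ^ n := by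
    refine ratEval_injective transcendental_varT.inv' ?_
    rw [map_mul, map_zpow₀, ratEval_X, AlgHom.commutes, algebraMap_laurentSeries, ← h1, hdiag,
      mul_right_comm, ← mul_zpow, mul_inv_cancel₀ varT_ne_zero, one_zpow, one_mul]
  rw [hslice, h2, map_mul, map_zpow₀, ratEval_X, AlgHom.commutes, algebraMap_laurentSeries,
    mul_comm]

/-- The matrix coefficients of the products in the two orders are expansions of the same rational
function. -/
theorem diag_revProd {u v : V} {r : ℕ} {u' v' : Fin r → V} {f : Fin r → RatFunc ℂ} {k : ℕ}
    (h : TrigLocality A u v u' v' f k) (w : W) (μ : Module.Dual ℂ W) (n : ℤ) {R : RatFunc ℂ}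
    (hR : slice n (pairing μ (iterOp M.Y (A.Y u v) w))
      = ratEval expSeries transcendental_expSeries R) :
    diag n (pairing μ (revProd M.Y (fun i => (f i).eval (algebraMap ℂ ScalarTwo)
      (varOuter / varInner)) u' v' w)) = ratEval varT transcendental_varT R := by
  choose p _ H using fun i => exists_rational M (v' i) (u' i)
  choose S _ hdiag hslice using fun i => H i w μ n
  obtain ⟨E, hE, hskew⟩ := skew_symmetry A (matrixCoeff M.Y μ w n) h
  have hE' : ∀ i, E i = ratEval expSeries transcendental_expSeries
      (RatFunc.X ^ n * reciprocal (S i)) := by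
    intro i
    have h1 : ratEval expSeries⁻¹ transcendental_expSeries.inv' (S i)
        = negVar (mapSeries (matrixCoeff M.Y μ w n) (A.Y (v' i) (u' i))) := by
      rw [← slice_pairing_iterOp, hslice, ratEval_apply transcendental_expSeries, map_eval_ratFunc,
        negVar_expSeries, ratEval_apply]
    rw [map_mul, map_zpow₀, ratEval_X, ratEval_reciprocal, h1]
    ext c
    rw [hE, coeff_mul_eq_finsum]
    refine finsum_congr fun j => ?_
    have h2 := congrArg (fun g => HahnSeries.coeff g (c - j))
      (slice_iterOp_vac M (coeffOne (A.Y (v' i) (u' i)) j) w μ n)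
    simp only [slice_pairing_iterOp] at h2
    rw [mul_comm (expSeries ^ n), HahnSeries.C_mul_eq_smul, HahnSeries.coeff_smul,
      smul_eq_mul] at h2
    rw [negVar_coeff, mul_left_comm, mul_comm ((expSeries ^ n).coeff (c - j))]
    exact congrArg _ h2
  have hsum : R = ∑ i, f i * (RatFunc.X ^ n * reciprocal (S i)) := by
    refine ratEval_injective transcendental_expSeries ?_
    rw [← hR, slice_pairing_iterOp, hskew, map_sum]
    exact Finset.sum_congr rfl fun i _ => by rw [map_mul, hE']
  rw [pairing_revProd, map_sum, hsum, map_sum]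
  refine Finset.sum_congr rfl fun i _ => ?_
  rw [← homog_varT, ← map_eval_ratFunc, diag_homog_mul, hdiag, map_mul, map_mul, map_zpow₀,
    ratEval_X, ratEval_reciprocal, ratEval_apply transcendental_varT]

theorem mapSeries_substLog (μ : Module.Dual ℂ V) (s : HahnModule ℤ ℂ V) :
    mapSeries μ (substLog s) = logSubst (mapSeries μ s) := by
  ext n
  rw [logSubst_coeff]
  change μ (∑ᶠ m : ℤ, (logSeries ^ m).coeff n • coeffOne s m) = _
  have hzero : ∀ m ∉ Finset.Icc ((HahnModule.of ℂ).symm s).order n,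
      (logSeries ^ m).coeff n = 0 ∨ coeffOne s m = 0 := by
    intro m hm
    rw [Finset.mem_Icc] at hm
    rcases lt_or_ge n m with h | h
    · exact Or.inl (coeff_logSeries_zpow h)
    · refine Or.inr (HahnSeries.coeff_eq_zero_of_lt_order ?_)
      by_contra h'
      exact hm ⟨not_lt.1 h', h⟩
  rw [finsum_eq_sum_of_support_subset (s := Finset.Icc ((HahnModule.of ℂ).symm s).order n),
    finsum_eq_sum_of_support_subset (s := Finset.Icc ((HahnModule.of ℂ).symm s).order n), map_sum]
  · exact Finset.sum_congr rfl fun m _ => by rw [map_smul, smul_eq_mul]; rfl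
  · intro m hm
    by_contra hc
    refine hm ?_
    change (logSeries ^ m).coeff n * μ (coeffOne s m) = 0
    rcases hzero m hc with h | h <;> simp [h]
  · intro m hm
    by_contra hc
    refine hm ?_
    change (logSeries ^ m).coeff n • coeffOne s m = 0
    rcases hzero m hc with h | h <;> simp [h]

theorem transcendental_one_add_varT : Transcendental ℂ (1 + varT) :=
  transcendental_laurentSeries one_ne_zero (by simp [HahnSeries.coeff_one])

theorem slice_iterOp_substLog (u v : V) (w : W) (μ : Module.Dual ℂ W) (n : ℤ) {R : RatFunc ℂ}
    (hR : slice n (pairing μ (iterOp M.Y (A.Y u v) w))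
      = ratEval expSeries transcendental_expSeries R) :
    slice n (pairing μ (iterOp M.Y (substLog (A.Y u v)) w))
      = ratEval (1 + varT) transcendental_one_add_varT R := by
  rw [slice_pairing_iterOp, mapSeries_substLog, ← slice_pairing_iterOp, hR, ratEval_apply,
    ratEval_apply, ← logSubst_expSeries]
  exact map_eval_ratFunc logSubstHom expSeries R

end Module

/-! ### The Jacobi identity for one matrix coefficient -/

section MatrixIdentity

variable {V W : Type*} [AddCommGroup V] [Module ℂ V] [AddCommGroup W] [Module ℂ W]

theorem coeff_homog_mul (g : LaurentSeries ℂ) (s : ScalarTwo) (a b : ℤ) :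
    (varInner ^ (-1 : ℤ) * (homog g * s)).coeff a b = (g * diag (a + b + 1) s).coeff b := by
  rw [coeff_varInner_zpow_mul, ← diag_homog_mul, diag_coeff]
  congr 1
  ring

/-- The coefficients of `x₁^a x^b z^c` in the first term, for a matrix coefficient that is the
expansion of `R(t)` at `t = ∞` with `p(t) R(t) = ∑ G_i t^i`. -/
theorem coeff_first {p : ℂ[X]} {R : RatFunc ℂ} {s : Finset ℤ} {G : ℤ → ℂ}
    (hG : aeval RatFunc.X p * R = ∑ i ∈ s, algebraMap ℂ (RatFunc ℂ) (G i) * RatFunc.X ^ i)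
    (g : ScalarTwo) (a b c : ℤ)
    (hg : diag (a + b + 1) g
      = varT ^ (a + b + 1) * ratEval varT⁻¹ transcendental_varT.inv' R) :
    ((varOuter ^ c * (varInner - varOuter) ^ (-c - 1))
        * (aeval (varInner / varOuter) p * g)).coeff a b
      = ∑ i ∈ s, G i * ((1 - varT) ^ (-c - 1)).coeff (i - a - 1 - c) := by
  have h1 : varOuter ^ c * (varInner - varOuter) ^ (-c - 1)
      = varInner ^ (-1 : ℤ) * homog (varT ^ c * (1 - varT) ^ (-c - 1)) := by
    rw [varInner_sub_varOuter_zpow, map_mul, map_zpow₀ homog varT, homog_varT, div_zpow,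
      show (-c - 1 : ℤ) = -1 - c by ring, zpow_sub₀ varInner_ne_zero]
    ring
  rw [h1, varInner_div_varOuter, aeval_algHom_apply, mul_assoc, ← mul_assoc (homog _),
    ← map_mul homog, coeff_homog_mul, hg, ← ratEval_aeval_X transcendental_varT.inv']
  rw [show ∀ x y z w : LaurentSeries ℂ, x * y * (z * w) = x * z * (y * w) from
    fun x y z w => by ring, ← map_mul (ratEval _ _), hG, ratEval_laurent, Finset.mul_sum,
    Finset.sum_congr rfl fun i _ => mul_left_comm _ _ _, coeff_sum_C_mul]
  refine Finset.sum_congr rfl fun i _ => ?_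
  rw [show varT ^ c * (1 - varT) ^ (-c - 1) * varT ^ (a + b + 1) * varT⁻¹ ^ i
      = varT ^ (c + (a + b + 1) - i) * (1 - varT) ^ (-c - 1) by
    generalize a + b + 1 = n
    rw [zpow_sub₀ varT_ne_zero, zpow_add₀ varT_ne_zero, inv_zpow]
    ring, coeff_varT_zpow_mul]
  congr 2
  ring

/-- The coefficients of `x₁^a x^b z^c` in the second term, for a matrix coefficient that is the
expansion of `R(t)` at `t = 0` with `p(t) R(t) = ∑ G_i t^i`. -/
theorem coeff_second {p : ℂ[X]} {R : RatFunc ℂ} {s : Finset ℤ} {G : ℤ → ℂ}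
    (hG : aeval RatFunc.X p * R = ∑ i ∈ s, algebraMap ℂ (RatFunc ℂ) (G i) * RatFunc.X ^ i)
    (g : ScalarTwo) (a b c : ℤ)
    (hg : diag (b + a + 1) g = ratEval varT transcendental_varT R) :
    (((-1) ^ (-c - 1) * varInner ^ c * (varInner - varOuter) ^ (-c - 1))
        * (aeval (varOuter / varInner) p * g)).coeff b a
      = ∑ i ∈ s, G i * (- ((-1) ^ c * ((1 - varT) ^ (-c - 1)).coeff (a - i))) := by
  have hsign : (-1 : ℂ) ^ (-c - 1) = - (-1) ^ c := by
    rw [zpow_sub_one₀ (by norm_num), zpow_neg, ← inv_zpow, inv_neg_one]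
    ring
  have h1 : (-1) ^ (-c - 1) * varInner ^ c * (varInner - varOuter) ^ (-c - 1)
      = varInner ^ (-1 : ℤ) * homog (HahnSeries.C (- (-1) ^ c) * (1 - varT) ^ (-c - 1)) := by
    rw [varInner_sub_varOuter_zpow, map_mul homog, ← hsign, ← algebraMap_laurentSeries,
      AlgHom.commutes, map_zpow₀ (algebraMap ℂ ScalarTwo), map_neg, map_one,
      show varInner ^ (-1 : ℤ) = varInner ^ c * varInner ^ (-c - 1) by
        rw [← zpow_add₀ varInner_ne_zero]; congr 1; ring]
    ring
  rw [h1, ← homog_varT, aeval_algHom_apply, mul_assoc, ← mul_assoc (homog _),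
    ← map_mul homog, coeff_homog_mul, hg, ← ratEval_aeval_X transcendental_varT, mul_assoc,
    ← map_mul (ratEval _ _), hG, ratEval_laurent, Finset.mul_sum,
    Finset.sum_congr rfl fun i _ => mul_left_comm _ _ _, coeff_sum_C_mul]
  refine Finset.sum_congr rfl fun i _ => ?_
  rw [mul_assoc, HahnSeries.C_mul_eq_smul, HahnSeries.coeff_smul, smul_eq_mul,
    mul_comm _ (varT ^ i), coeff_varT_zpow_mul, neg_mul]

/-- The coefficients of `x₁^a x^b z^c` in the third term, for a matrix coefficient equal to
`R(1 + z)` with `p(t) R(t) = ∑ G_i t^i`. -/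
theorem coeff_third (μ : Module.Dual ℂ W) {p : ℂ[X]} {R : RatFunc ℂ} {s : Finset ℤ} {G : ℤ → ℂ}
    (hG : aeval RatFunc.X p * R = ∑ i ∈ s, algebraMap ℂ (RatFunc ℂ) (G i) * RatFunc.X ^ i)
    (g : LaurentTwo W) (a b c : ℤ)
    (hg : slice (a + b + 1) (pairing μ g) = ratEval (1 + varT) transcendental_one_add_varT R) :
    μ (ratioMul p (fun a b c => coeffTwo ((varInner * (1 + varOuter)) ^ (-a - 1) • g) b c) a b c)
      = ∑ i ∈ s, G i * ((1 + varT) ^ (i - a - 1)).coeff c := by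
  have hne : (1 + varT) ≠ 0 := fun h => transcendental_one_add_varT (h ▸ isAlgebraic_zero)
  have h1 : ∀ k : ℕ, μ (coeffTwo ((varInner * (1 + varOuter)) ^ (-(a - k) - 1) • g) (b + k) c)
      = ((1 + varT) ^ (-a - 1) * ((1 + varT) ^ k
        * ratEval (1 + varT) transcendental_one_add_varT R)).coeff c := by
    intro k
    rw [← coeff_pairing, map_smul, smul_eq_mul, mul_zpow, mul_assoc, ← slice_coeff,
      slice_varInner_zpow_mul, varOuter, inOuter_eq, ← map_one inOuterHom, ← map_add,
      ← map_zpow₀, ← inOuter_eq, slice_inOuter_mul,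
      show b + k - (-(a - k) - 1) = a + b + 1 by ring, hg, ← mul_assoc, ← zpow_natCast,
      ← zpow_add₀ hne]
    congr 4
    ring
  have h2 : aeval (1 + varT) p * ratEval (1 + varT) transcendental_one_add_varT R
      = p.sum fun k r => HahnSeries.C r * ((1 + varT) ^ k
        * ratEval (1 + varT) transcendental_one_add_varT R) := by
    rw [aeval_def, eval₂_eq_sum, Polynomial.sum, Polynomial.sum, Finset.sum_mul]
    exact Finset.sum_congr rfl fun k _ => by rw [algebraMap_laurentSeries, mul_assoc]
  have h3 := congrArg (fun h => ((1 + varT) ^ (-a - 1) * h).coeff c) h2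
  rw [← ratEval_aeval_X transcendental_one_add_varT, ← map_mul, hG, ratEval_laurent] at h3
  simp only [Polynomial.sum, Finset.mul_sum] at h3
  rw [Finset.sum_congr rfl fun i _ => mul_left_comm _ _ _, coeff_sum_C_mul,
    Finset.sum_congr rfl fun i _ => mul_left_comm _ (HahnSeries.C _) _, HahnSeries.coeff_sum] at h3
  rw [ratioMul, Polynomial.sum, map_sum]
  refine Eq.trans (Finset.sum_congr rfl fun k _ => ?_) (h3.symm.trans
    (Finset.sum_congr rfl fun i _ => ?_))
  · rw [map_smul, h1, HahnSeries.C_mul_eq_smul, HahnSeries.coeff_smul]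
  · rw [← zpow_add₀ hne]
    congr 3
    ring

end MatrixIdentity

end

/-- The three terms are compared through their coefficients of `x₁^a x^b z^c`, applied to `w`.
The coefficient of `z^c` in `(xz)⁻¹ δ((x₁ - x)/(xz)) = ∑_n (xz)^{-n-1} (x₁ - x)^n` is
`x^c (x₁ - x)^{-c-1}`, in `ℂ((x₁))((x))`; in `(xz)⁻¹ δ((x - x₁)/(-xz))` it is
`(-1)^{-c-1} x^c (x - x₁)^{-c-1}`, in `ℂ((x))((x₁))`. The coefficient of `x₁^a` in
`x₁⁻¹ δ(x(1 + z)/x₁)` is `(x(1 + z))^{-a-1}`, in `ℂ((x))((z))`. -/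
theorem proposition4p5 {V W : Type*} [AddCommGroup V] [Module ℂ V] [AddCommGroup W] [Module ℂ W]
    (A : WeakQuantumVertexAlgebra V) (M : PhiCoordinatedQuasiModule A W)
    (u v : V) (r : ℕ) (u' v' : Fin r → V) (f : Fin r → RatFunc ℂ)
    (h : ∃ k : ℕ, TrigLocality A u v u' v' f k) :
    ∃ p : Polynomial ℂ, p ≠ 0 ∧ ∀ (w : W) (a b c : ℤ),
      coeffTwo
          ((ScalarTwo.varOuter ^ c * (ScalarTwo.varInner - ScalarTwo.varOuter) ^ (-c - 1)) •
            (Polynomial.aeval (ScalarTwo.varInner / ScalarTwo.varOuter) p •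
              prodOp (M.Y u) (M.Y v) w)) a b
        - coeffTwo
          (((-1) ^ (-c - 1) * ScalarTwo.varInner ^ c *
              (ScalarTwo.varInner - ScalarTwo.varOuter) ^ (-c - 1)) •
            (Polynomial.aeval (ScalarTwo.varOuter / ScalarTwo.varInner) p •
              revProd M.Y (fun i => (f i).eval (algebraMap ℂ ScalarTwo)
                (ScalarTwo.varOuter / ScalarTwo.varInner)) u' v' w)) b a
      = ratioMul p
          (fun a b c => coeffTwo
            ((ScalarTwo.varInner * (1 + ScalarTwo.varOuter)) ^ (-a - 1) •
              iterOp M.Y (substLog (A.Y u v)) w) b c) a b c := by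
  obtain ⟨k, hk⟩ := h
  obtain ⟨p, hp, H⟩ := exists_rational M u v
  refine ⟨p, hp, fun w a b c => ?_⟩
  rw [← sub_eq_zero, ← Module.forall_dual_apply_eq_zero_iff ℂ]
  intro μ
  obtain ⟨R, ⟨s, G, hG⟩, hdiag, hslice⟩ := H w μ (a + b + 1)
  rw [map_sub, map_sub, sub_eq_zero, ← coeff_pairing, ← coeff_pairing, map_smul, map_smul,
    map_smul, map_smul, smul_eq_mul, smul_eq_mul, smul_eq_mul, smul_eq_mul,
    coeff_first hG _ a b c hdiag,
    coeff_second hG _ a b c (by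
      rw [add_comm b a]
      exact diag_revProd M hk w μ _ hslice),
    coeff_third μ hG _ a b c (slice_iterOp_substLog M u v w μ _ hslice), ← Finset.sum_sub_distrib]
  refine Finset.sum_congr rfl fun i _ => ?_
  rw [← coeff_expansion_sub, show -(i - a - 1) - 1 = a - i by ring]
  ring
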